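/- Let $\mathcal H_A=\mathbb C^a$ and $\mathcal H_B=\mathbb C^b$ be finite-dimensional Hilbert spaces of two parties, each with an orthonormal basis of particle-number states; let $\Pi_n^A,\Pi_m^B$ be the projectors onto the local subspaces with $n$ (resp. $m$) particles, and $\Pi_n=\Pi_n^A\otimes 1$. Let $\rho$ be a density matrix on $\mathcal H_A\otimes\mathcal H_B$ with a fixed total number $N$ of particles. Definitions. $E$ is the entanglement of formation, $E(\sigma)=\inf\sum_i q_i\,S(\mathrm{Tr}_B|\psi_i\rangle\langle\psi_i|)$ over all finite pure-state decompositions $\sigma=\sum_i q_i|\psi_i\rangle\langle\psi_i|$, with $S$ the von Neumann entropy. In a semiquantum nonlocal game a referee draws independently $s$ with probability $p(s)$ and $t$ with probability $q(t)$ and sends the states $\zeta^s$ to Alice and $\eta^t$ to Bob; each party applies a POVM to the question state together with its share of a common state, and they return answers $x,y$ and receive $\mathfrak p(s,t,x,y)$; all index sets are finite, and all spaces finite-dimensional. Let $\wp(\sigma)$ be the maximal average payoff with shared state $\sigma$ over all local POVMs. For a completely positive map $\$$ with dual $\$^\dagger$, let $\wp_{\$}(\rho)$ be the maximal average payoff with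 shared state $\rho$ over those POVMs whose effective POVM on the shared state (after inserting $\zeta^s,\eta^t$) is, for all $s,t$, of the form $\{\$^\dagger[G_k]\}$ for some POVM $\{G_k\}$ on $\mathcal H_A\otimes\mathcal H_B$. The effective entanglement of formation $\bar E_{\$}(\rho)$ is the infimum of $E(\sigma)$ over all states $\sigma$ on $\mathcal H_A\otimes\mathcal H_B$ such that $\wp(\sigma)\ge\wp_{\$}(\rho)$ for every semiquantum nonlocal game. With no reference frame, the super-selection restriction is the dephasing map $\$_A[\rho]=\sum_n\Pi_n\rho\Pi_n$ for Alice, $\$_B[\rho]=\sum_m(1\otimes\Pi^B_m)\rho(1\otimes\Pi^B_m)$ for Bob, or $\$_{AB}[\rho]=\sum_{n,m}(\Pi^A_n\otimes\Pi^B_m)\rho(\Pi^A_n\otimes\Pi^B_m)$ for both. Put $p_n=\mathrm{Tr}(\Pi_n\rho)$ and $\rho_n=\Pi_n\rho\Pi_n/p_n$ (terms with $p_n=0$ are $0$). Then: 1. The three maps send $\rho$ to the same state $\bar\rho=\sum_n p_n\rho_n$, and $\bar E_{\$_A}(\rho)=\bar E_{\$_B}(\rho)=\bar E_{\$_{AB}}(\rho)=E(\bar\rho)$.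 2. $E(\bar\rho)\le\sum_n p_nE(\rho_n)$. 3. If $\rho=|\psi\rangle\langle\psi|$ is pure, then $E(\bar\rho)=\sum_n p_nE(\rho_n)$, and this equals the Wiseman–Vaccaro entanglement of particles $\sum_n P_n\,S(\mathrm{Tr}_B|\psi_n\rangle\langle\psi_n|)$, where $P_n=\|(\Pi_n^A\otimes\Pi_{N-n}^B)\psi\|^2$ and $\psi_n=(\Pi_n^A\otimes\Pi_{N-n}^B)\psi/\sqrt{P_n}$ (terms with $P_n=0$ are $0$). -/

import Mathlib

open scoped Kronecker ComplexOrder Matrix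

universe u

noncomputable section

namespace EffEnt

/-! ### States, measurements, completely positive maps in Kraus form -/

section Basic

variable {H : Type*} [Fintype H] [DecidableEq H]

/-- Density matrices on `ℂ^H`. -/
def IsState (ρ : Matrix H H ℂ) : Prop :=
  ρ.PosSemidef ∧ ρ.trace = 1

/-- A positive operator-valued measure on `ℂ^H` with outcomes in `X`. -/
def IsPOVM {X : Type*} [Fintype X] (P : X → Matrix H H ℂ) : Prop :=
  (∀ x, (P x).PosSemidef) ∧ ∑ x, P x = 1

/-- Squared Euclidean norm of a vector. -/
def normSq (ψ : H → ℂ) : ℝ := ∑ i, ‖ψ i‖ ^ 2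

/-- The operator `|ψ⟩⟨ψ|`. -/
def ketbra (ψ : H → ℂ) : Matrix H H ℂ := Matrix.vecMulVec ψ (star ψ)

/-- `$[ρ] = ∑ₖ Kₖ ρ Kₖ†`. -/
def krausMap {κ : Type*} (s : Finset κ) (K : κ → Matrix H H ℂ) (ρ : Matrix H H ℂ) :
    Matrix H H ℂ :=
  ∑ k ∈ s, K k * ρ * (K k)ᴴ

/-- The Heisenberg-picture map `$†[P] = ∑ₖ Kₖ† P Kₖ`. -/
def krausDual {κ : Type*} (s : Finset κ) (K : κ → Matrix H H ℂ) (P : Matrix H H ℂ) :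
    Matrix H H ℂ :=
  ∑ k ∈ s, (K k)ᴴ * P * K k

/-- Von Neumann entropy (in bits) of a Hermitian matrix, through its eigenvalues. -/
def entropy {ρ : Matrix H H ℂ} (h : ρ.IsHermitian) : ℝ :=
  ∑ i, Real.negMulLog (h.eigenvalues i) / Real.log 2

end Basic

/-! ### Entanglement of formation -/

section Entanglement

variable {a b : Type*} [Fintype a] [DecidableEq a] [Fintype b] [DecidableEq b]

/-- The coefficient matrix `A` of `ψ = ∑ᵢⱼ Aᵢⱼ |i⟩|j⟩`. The reduced state `Tr_B |ψ⟩⟨ψ|` is `A A†`. -/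
def coeff (ψ : a × b → ℂ) : Matrix a b ℂ := Matrix.of fun i j => ψ (i, j)

/-- Entropy of entanglement of a pure state: the entropy of its reduced state `A A†`. -/
def pureEntanglement (ψ : a × b → ℂ) : ℝ :=
  entropy (Matrix.isHermitian_mul_conjTranspose_self (coeff ψ))

/-- Entanglement of formation: the infimum of the average entropy of entanglement over
all finite pure-state decompositions of the state. -/
def entanglementOfFormation (ρ : Matrix (a × b) (a × b) ℂ) : ℝ :=
  sInf {e : ℝ | ∃ (k : ℕ) (p : Fin k → ℝ) (ψ : Fin k → a × b → ℂ),
    (∀ i, 0 ≤ p i) ∧ ∑ i, p i = 1 ∧ (∀ i, normSq (ψ i) = 1) ∧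
    ρ = ∑ i, (p i : ℂ) • ketbra (ψ i) ∧
    e = ∑ i, p i * pureEntanglement (ψ i)}

end Entanglement

/-! ### Semiquantum nonlocal games and effective entanglement -/

/-- A semiquantum nonlocal game: question indices `S`, `T` with distributions `p`, `q`, question
states `ζ s` on `ℂ^A₀` and `η t` on `ℂ^B₀`, answers in `X`, `Y`, and a payoff function. -/
structure Game (S T X Y A₀ B₀ : Type u) [Fintype S] [Fintype T] [Fintype A₀] [Fintype B₀] where
  p : S → ℝ
  q : T → ℝ
  p_nonneg : ∀ s, 0 ≤ p s
  q_nonneg : ∀ t, 0 ≤ q t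
  p_sum : ∑ s, p s = 1
  q_sum : ∑ t, q t = 1
  ζ : S → Matrix A₀ A₀ ℂ
  η : T → Matrix B₀ B₀ ℂ
  ζ_state : ∀ s, IsState (ζ s)
  η_state : ∀ t, IsState (η t)
  pay : S → T → X → Y → ℝ

section Games

variable {a b S T X Y A₀ B₀ : Type u} [Fintype a] [DecidableEq a] [Fintype b] [DecidableEq b]
  [Fintype S] [Fintype T] [Fintype X] [Fintype Y]
  [Fintype A₀] [DecidableEq A₀] [Fintype B₀] [DecidableEq B₀]

/-- The state `ζ ⊗ ρ ⊗ η` with tensor factors ordered as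
(Alice's question, Alice's share), (Bob's question, Bob's share). -/
def jointState (ζ : Matrix A₀ A₀ ℂ) (ρ : Matrix (a × b) (a × b) ℂ) (η : Matrix B₀ B₀ ℂ) :
    Matrix ((A₀ × a) × (B₀ × b)) ((A₀ × a) × (B₀ × b)) ℂ :=
  Matrix.of fun v w =>
    ζ v.1.1 w.1.1 * ρ (v.1.2, v.2.2) (w.1.2, w.2.2) * η v.2.1 w.2.1

/-- The probability `μ(x, y | s, t)` of answers `x`, `y` when Alice and Bob, sharing `ρ`, apply the
measurements `P`, `Q` to their question systems together with their shares of `ρ`. -/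
def outcomeProb (G : Game S T X Y A₀ B₀) (ρ : Matrix (a × b) (a × b) ℂ)
    (P : X → Matrix (A₀ × a) (A₀ × a) ℂ) (Q : Y → Matrix (B₀ × b) (B₀ × b) ℂ)
    (s : S) (t : T) (x : X) (y : Y) : ℝ :=
  (((P x) ⊗ₖ (Q y)) * jointState (G.ζ s) ρ (G.η t)).trace.re

/-- The average payoff of the strategy `(P, Q)`. -/
def averagePayoff (G : Game S T X Y A₀ B₀) (ρ : Matrix (a × b) (a × b) ℂ)
    (P : X → Matrix (A₀ × a) (A₀ × a) ℂ) (Q : Y → Matrix (B₀ × b) (B₀ × b) ℂ) : ℝ :=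
  ∑ s, ∑ t, ∑ x, ∑ y, G.p s * G.q t * G.pay s t x y * outcomeProb G ρ P Q s t x y

/-- The maximum average payoff of `ρ` with unrestricted measurements. -/
def payoff (G : Game S T X Y A₀ B₀) (ρ : Matrix (a × b) (a × b) ℂ) : ℝ :=
  sSup {r : ℝ | ∃ (P : X → Matrix (A₀ × a) (A₀ × a) ℂ) (Q : Y → Matrix (B₀ × b) (B₀ × b) ℂ),
    IsPOVM P ∧ IsPOVM Q ∧ r = averagePayoff G ρ P Q}

/-- The effective operator `Tr_{A₀}[M (ζ ⊗ 1)]` on the share of the resource, of a joint operator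
`M` on question and share, given the question state `ζ`. -/
def effectiveOp (M : Matrix (A₀ × a) (A₀ × a) ℂ) (ζ : Matrix A₀ A₀ ℂ) : Matrix a a ℂ :=
  Matrix.of fun i j => ∑ k, (M * (ζ ⊗ₖ (1 : Matrix a a ℂ))) (k, i) (k, j)

/-- The set of realizable measurements on the resource: those that arise from an arbitrary POVM
by the Heisenberg-picture map `$†`, where `$` has Kraus operators `K k`, `k ∈ s`. -/
def restrictedPOVMs {κ O : Type*} [Fintype O] (s : Finset κ)
    (K : κ → Matrix (a × b) (a × b) ℂ) : Set (O → Matrix (a × b) (a × b) ℂ) :=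
  {F | ∃ F₀ : O → Matrix (a × b) (a × b) ℂ, IsPOVM F₀ ∧ ∀ o, F o = krausDual s K (F₀ o)}

/-- The maximum average payoff of `ρ` over those measurements whose effective POVM on `ρ` alone is,
for all questions, in the restricted set. -/
def restrictedPayoff {κ : Type*} (k : Finset κ) (K : κ → Matrix (a × b) (a × b) ℂ)
    (G : Game S T X Y A₀ B₀) (ρ : Matrix (a × b) (a × b) ℂ) : ℝ :=
  sSup {r : ℝ | ∃ (P : X → Matrix (A₀ × a) (A₀ × a) ℂ) (Q : Y → Matrix (B₀ × b) (B₀ × b) ℂ),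
    IsPOVM P ∧ IsPOVM Q ∧
    (∀ s t, (fun o : X × Y => effectiveOp (P o.1) (G.ζ s) ⊗ₖ effectiveOp (Q o.2) (G.η t))
      ∈ restrictedPOVMs k K) ∧
    r = averagePayoff G ρ P Q}

end Games

section Effective

variable {a b : Type u} [Fintype a] [DecidableEq a] [Fintype b] [DecidableEq b]

/-- `σ` with unrestricted measurements performs at least as well as `ρ` with restricted ones,
in every semiquantum nonlocal game. -/
def Outperforms {κ : Type*} (k : Finset κ) (K : κ → Matrix (a × b) (a × b) ℂ)
    (ρ σ : Matrix (a × b) (a × b) ℂ) : Prop :=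
  ∀ (S T X Y A₀ B₀ : Type u) [Fintype S] [Fintype T] [Fintype X] [Fintype Y]
    [Nonempty X] [Nonempty Y]
    [Fintype A₀] [DecidableEq A₀] [Fintype B₀] [DecidableEq B₀] (G : Game S T X Y A₀ B₀),
    restrictedPayoff k K G ρ ≤ payoff G σ

/-- The effective entanglement of `ρ`, for the entanglement measure `E` and the restriction given
by the Kraus operators `K k`: the least entanglement of a state that outperforms `ρ`. -/
def effectiveEntanglement {κ : Type*} (k : Finset κ) (K : κ → Matrix (a × b) (a × b) ℂ)
    (E : Matrix (a × b) (a × b) ℂ → ℝ) (ρ : Matrix (a × b) (a × b) ℂ) : ℝ :=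
  sInf {e : ℝ | ∃ σ : Matrix (a × b) (a × b) ℂ, IsState σ ∧ Outperforms k K ρ σ ∧ e = E σ}

end Effective

/-! ### The particle-number super-selection rule

A local Hilbert space with a particle number operator is `ℂ^a`, where the basis states `i : a`
(occupation number states) have `num i` particles. -/

section SSR

variable {a b : Type*} [Fintype a] [DecidableEq a] [Fintype b] [DecidableEq b]

/-- The finitely many particle numbers that occur. -/
def sectors (num : a → ℕ) : Finset ℕ := Finset.univ.image num

/-- The projector onto the subspace of `n` particles. -/
def numberProj (num : a → ℕ) (n : ℕ) : Matrix a a ℂ :=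
  Matrix.diagonal fun i => if num i = n then 1 else 0

/-- `ρ` is a state of exactly `N` particles in total. -/
def HasTotalNumber (nA : a → ℕ) (nB : b → ℕ) (N : ℕ) (ρ : Matrix (a × b) (a × b) ℂ) : Prop :=
  numberProj (fun v : a × b => nA v.1 + nB v.2) N * ρ *
    numberProj (fun v : a × b => nA v.1 + nB v.2) N = ρ

/-- `Π_n ⊗ 1`: the projectors for Alice's local particle number. -/
def aliceProj (b : Type*) [DecidableEq b] (nA : a → ℕ) (n : ℕ) : Matrix (a × b) (a × b) ℂ :=
  numberProj nA n ⊗ₖ (1 : Matrix b b ℂ)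

/-- `1 ⊗ Π_m`: the projectors for Bob's local particle number. -/
def bobProj (a : Type*) [DecidableEq a] (nB : b → ℕ) (m : ℕ) : Matrix (a × b) (a × b) ℂ :=
  (1 : Matrix a a ℂ) ⊗ₖ numberProj nB m

/-- `Π_n ⊗ Π_m`. -/
def bothProj (nA : a → ℕ) (nB : b → ℕ) (nm : ℕ × ℕ) : Matrix (a × b) (a × b) ℂ :=
  numberProj nA nm.1 ⊗ₖ numberProj nB nm.2

/-- `p_n = Tr(Π_n ρ)`. -/
def sectorProb (nA : a → ℕ) (ρ : Matrix (a × b) (a × b) ℂ) (n : ℕ) : ℝ :=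
  (aliceProj b nA n * ρ).trace.re

/-- The normalized block `ρ_n = Π_n ρ Π_n / p_n` (only meaningful if `p_n ≠ 0`). -/
def sectorState (nA : a → ℕ) (ρ : Matrix (a × b) (a × b) ℂ) (n : ℕ) :
    Matrix (a × b) (a × b) ℂ :=
  ((sectorProb nA ρ n : ℂ))⁻¹ • (aliceProj b nA n * ρ * aliceProj b nA n)

/-- The effective state `ρ̄ = ∑ₙ Π_n ρ Π_n`. -/
def ssrState (nA : a → ℕ) (ρ : Matrix (a × b) (a × b) ℂ) : Matrix (a × b) (a × b) ℂ :=
  krausMap (sectors nA) (aliceProj b nA) ρ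

/-- The Wiseman–Vaccaro entanglement of particles of a pure state `ψ` of `N` particles: the average
`∑ₙ Pₙ S(ψₙ)` over the outcomes of a measurement of the local particle numbers `(n, N - n)`, where
`ψₙ` is the normalized projection of `ψ` and `S` the entropy of entanglement. -/
def entanglementOfParticles (nA : a → ℕ) (nB : b → ℕ) (N : ℕ) (ψ : a × b → ℂ) : ℝ :=
  ∑ nm ∈ Finset.HasAntidiagonal.antidiagonal N,
    normSq (bothProj nA nB nm *ᵥ ψ) *
      pureEntanglement
        (((Real.sqrt (normSq (bothProj nA nB nm *ᵥ ψ)) : ℂ))⁻¹ • (bothProj nA nB nm *ᵥ ψ))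

end SSR

end EffEnt

end

open EffEnt

set_option linter.unusedSectionVars false

noncomputable section

namespace EffEnt

/-! ### Spectral sums of Hermitian matrices -/

section SpectralSum

variable {H H' : Type*} [Fintype H] [DecidableEq H] [Fintype H'] [DecidableEq H']

/-! The restriction is a pinching in the local particle numbers, which is idempotent and
self-adjoint for the trace pairing. It can therefore be moved from the measurements to the state:
the restricted payoff of ρ is the ordinary payoff of the pinched state ρ̄
(`restrictedPayoff_eq_payoff_pinch`). Because the total number is fixed, the numbers of Alice and
Bob determine each other on the support of ρ, so the three pinchings agree
(`HasTotalNumber.pinch_eq`).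

Thus ρ̄ is itself admissible in the infimum, and what remains is that games detect entanglement: if
σ does at least as well as τ in every game, then E(τ) ≤ E(σ)
(`entanglementOfFormation_le_of_payoff_le`). By compactness and Hahn–Banach, every correlation of τ
is a convex mixture of correlations of σ. Apply this to teleportation: the question states are
informationally complete, so correlations determine operators on the question spaces, and the
measurements on τ are in rotated Bell vectors, which reproduce τ up to known local unitaries.
Undoing these unitaries in the mixture for σ yields a local channel with shared randomness that
sends σ to τ.

E decreases under such channels because entropy is concave. This is used in a homogeneous form
(`sum_unnormalizedEntropy_le`), so that decompositions become sums of unnormalized vectors with cost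
`entWeight`.

The upper bound is convexity of E. For pure ψ, any decomposition of ρ̄ projects in each sector to a
decomposition of a pure vector, and all of these cost the same (`sum_entWeight_eq_of_ketbra_eq`).
The local number measurement does not raise the average cost, so the bound is attained. -/

/-- The sum of `f` over the (real parts of the) eigenvalues of `M`, with multiplicity. -/
def spectralSum (f : ℝ → ℝ) (M : Matrix H H ℂ) : ℝ :=
  (M.charpoly.roots.map fun z => f z.re).sum

theorem spectralSum_eq_sum_eigenvalues (f : ℝ → ℝ) {M : Matrix H H ℂ} (h : M.IsHermitian) :
    spectralSum f M = ∑ i, f (h.eigenvalues i) := by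
  rw [spectralSum, h.roots_charpoly_eq_eigenvalues, Multiset.map_map]
  rfl

theorem entropy_eq_spectralSum {M : Matrix H H ℂ} (h : M.IsHermitian) :
    entropy h = spectralSum Real.negMulLog M / Real.log 2 := by
  rw [spectralSum_eq_sum_eigenvalues _ h, entropy, Finset.sum_div]

theorem exists_spectral_decomposition {M : Matrix H H ℂ} (h : M.IsHermitian) :
    ∃ U : Matrix H H ℂ, U * Uᴴ = 1 ∧ Uᴴ * U = 1 ∧
      M = U * Matrix.diagonal (fun i => (h.eigenvalues i : ℂ)) * Uᴴ := by
  refine ⟨h.eigenvectorUnitary, ?_, ?_, ?_⟩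
  · exact Unitary.coe_mul_star_self h.eigenvectorUnitary
  · exact Unitary.coe_star_mul_self h.eigenvectorUnitary
  · conv_lhs => rw [h.spectral_theorem, Unitary.conjStarAlgAut_apply]
    rfl

theorem spectralSum_conj_diagonal (f : ℝ → ℝ) {U : Matrix H H ℂ} (hU : Uᴴ * U = 1) (d : H → ℝ) :
    spectralSum f (U * Matrix.diagonal (fun i => (d i : ℂ)) * Uᴴ) = ∑ i, f (d i) := by
  rw [spectralSum, Matrix.charpoly_mul_comm, ← mul_assoc, hU, one_mul, Matrix.charpoly_diagonal,
    Polynomial.roots_prod]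
  · simp
  · simp [Finset.prod_ne_zero_iff, Polynomial.X_sub_C_ne_zero]

theorem spectralSum_smul (f : ℝ → ℝ) {M : Matrix H H ℂ} (h : M.IsHermitian) (c : ℝ) :
    spectralSum f ((c : ℂ) • M) = spectralSum (fun x => f (c * x)) M := by
  obtain ⟨U, -, hU, hM⟩ := exists_spectral_decomposition h
  have : (c : ℂ) • M =
      U * Matrix.diagonal (fun i => ((c * h.eigenvalues i : ℝ) : ℂ)) * Uᴴ := by
    conv_lhs => rw [hM]
    rw [← Matrix.smul_mul, ← Matrix.mul_smul, ← Matrix.diagonal_smul]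
    congr 3
    ext i
    simp
  rw [this, spectralSum_conj_diagonal f hU, spectralSum_eq_sum_eigenvalues _ h]

/-- The two characteristic polynomials agree up to powers of X, so the spectra differ only in zeros,
which `f 0 = 0` hides. This is where the definition by roots pays off. It exchanges the two reduced
states of a vector. -/
theorem spectralSum_mul_comm {f : ℝ → ℝ} (hf : f 0 = 0) (A : Matrix H H' ℂ) (B : Matrix H' H ℂ) :
    spectralSum f (A * B) = spectralSum f (B * A) := by
  have h := congrArg Polynomial.roots (Matrix.charpoly_mul_comm' A B)
  rw [Polynomial.roots_mul, Polynomial.roots_mul, Polynomial.roots_X_pow,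
    Polynomial.roots_X_pow] at h
  · simpa [hf, spectralSum, Multiset.map_nsmul, Multiset.sum_nsmul] using
      congrArg (fun s : Multiset ℂ => (s.map fun z => f z.re).sum) h
  · exact mul_ne_zero (pow_ne_zero _ Polynomial.X_ne_zero) (Matrix.charpoly_monic _).ne_zero
  · exact mul_ne_zero (pow_ne_zero _ Polynomial.X_ne_zero) (Matrix.charpoly_monic _).ne_zero

theorem trace_re_eq_sum_eigenvalues {M : Matrix H H ℂ} (h : M.IsHermitian) :
    M.trace.re = ∑ i, h.eigenvalues i := by
  rw [h.trace_eq_sum_eigenvalues]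
  simp

theorem sum_normSq_row {W : Matrix H H ℂ} (hW : W * Wᴴ = 1) (i : H) :
    ∑ k, Complex.normSq (W i k) = 1 := by
  have := congrFun (congrFun hW i) i
  simp only [Matrix.mul_apply, Matrix.conjTranspose_apply, Matrix.one_apply_eq] at this
  exact_mod_cast (show ((∑ k, Complex.normSq (W i k) : ℝ) : ℂ) = 1 by
    rw [← this, Complex.ofReal_sum]
    exact Finset.sum_congr rfl fun k _ => (Complex.mul_conj _).symm)

theorem sum_normSq_col {W : Matrix H H ℂ} (hW : Wᴴ * W = 1) (k : H) :
    ∑ i, Complex.normSq (W i k) = 1 := by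
  have := sum_normSq_row (W := Wᴴ) (by simpa using hW) k
  simpa using this

/-- Peierls' inequality: for concave `f`, the spectral sum is at most the sum of `f` over the
diagonal entries in any orthonormal basis. -/
theorem spectralSum_le_sum_diag {f : ℝ → ℝ} (hf : ConcaveOn ℝ (Set.Ici 0) f) {M : Matrix H H ℂ}
    (hM : M.PosSemidef) {U : Matrix H H ℂ} (hU : U * Uᴴ = 1) (hU' : Uᴴ * U = 1) :
    spectralSum f M ≤ ∑ i, f ((Uᴴ * M * U) i i).re := by
  obtain ⟨V, hV, hV', hMV⟩ := exists_spectral_decomposition hM.isHermitian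
  set W := Uᴴ * V with hWdef
  have hW : W * Wᴴ = 1 := by
    rw [hWdef, Matrix.conjTranspose_mul, Matrix.conjTranspose_conjTranspose, Matrix.mul_assoc,
      ← Matrix.mul_assoc V, hV, Matrix.one_mul, hU']
  have hW' : Wᴴ * W = 1 := by
    rw [hWdef, Matrix.conjTranspose_mul, Matrix.conjTranspose_conjTranspose, Matrix.mul_assoc,
      ← Matrix.mul_assoc U, hU, Matrix.one_mul, hV']
  -- The diagonal entries are averages of the eigenvalues with weights |W i k|². Row sums equal to 1
  -- allow Jensen; column sums equal to 1 give back each eigenvalue once.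
  have hd : ∀ i, ((Uᴴ * M * U) i i).re =
      ∑ k, Complex.normSq (W i k) * hM.isHermitian.eigenvalues k := by
    intro i
    have : Uᴴ * M * U =
        W * Matrix.diagonal (fun i => (hM.isHermitian.eigenvalues i : ℂ)) * Wᴴ := by
      conv_lhs => rw [hMV]
      simp only [hWdef, Matrix.conjTranspose_mul, Matrix.conjTranspose_conjTranspose,
        Matrix.mul_assoc]
    rw [this, Matrix.mul_apply, Complex.re_sum]
    refine Finset.sum_congr rfl fun k _ => ?_
    rw [Matrix.mul_diagonal, Matrix.conjTranspose_apply, mul_right_comm, RCLike.star_def,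
      Complex.mul_conj, ← Complex.ofReal_mul, Complex.ofReal_re]
  rw [spectralSum_eq_sum_eigenvalues f hM.isHermitian]
  calc ∑ k, f (hM.isHermitian.eigenvalues k)
      = ∑ k, (∑ i, Complex.normSq (W i k)) * f (hM.isHermitian.eigenvalues k) := by
        simp [sum_normSq_col hW']
    _ = ∑ i, ∑ k, Complex.normSq (W i k) * f (hM.isHermitian.eigenvalues k) := by
        simp only [Finset.sum_mul]
        exact Finset.sum_comm
    _ ≤ ∑ i, f ((Uᴴ * M * U) i i).re := by
        refine Finset.sum_le_sum fun i _ => ?_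
        rw [hd]
        exact hf.le_map_sum (fun k _ => Complex.normSq_nonneg _) (sum_normSq_row hW i)
          (fun k _ => hM.eigenvalues_nonneg k)

end SpectralSum

/-! ### Superadditivity of the unnormalized entropy -/

section Superadditivity

/-- The log sum inequality. -/
theorem log_sum_inequality {J : Type*} (s : Finset J) (x t : J → ℝ) (hx : ∀ j ∈ s, 0 ≤ x j)
    (hxt : ∀ j ∈ s, x j ≤ t j) :
    ∑ j ∈ s, (Real.negMulLog (x j) + x j * Real.log (t j)) ≤
      Real.negMulLog (∑ j ∈ s, x j) + (∑ j ∈ s, x j) * Real.log (∑ j ∈ s, t j) := by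
  set X := ∑ j ∈ s, x j with hX
  set T := ∑ j ∈ s, t j with hT
  have hX0 : 0 ≤ X := Finset.sum_nonneg hx
  rcases hX0.eq_or_lt with h0 | hXpos
  · have hz : ∀ j ∈ s, x j = 0 := (Finset.sum_eq_zero_iff_of_nonneg hx).1 h0.symm
    rw [← h0, Finset.sum_eq_zero fun j hj => by simp [hz j hj]]
    simp
  have hXT : X ≤ T := Finset.sum_le_sum hxt
  have hTpos : 0 < T := hXpos.trans_le hXT
  -- This is `log z ≤ z - 1` at z = X t / (T x), multiplied by x. The corrections X / T * t - x sum
  -- to zero.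
  have key : ∀ j ∈ s, Real.negMulLog (x j) + x j * Real.log (t j) ≤
      x j * (Real.log T - Real.log X) + (X / T * t j - x j) := by
    intro j hj
    rcases (hx j hj).eq_or_lt with h0 | hpos
    · have : 0 ≤ X / T * t j :=
        mul_nonneg (by positivity) ((hx j hj).trans (hxt j hj))
      simpa [← h0] using this
    · have htpos : 0 < t j := hpos.trans_le (hxt j hj)
      have hl := Real.log_le_sub_one_of_pos (x := X / T * t j / x j) (by positivity)
      rw [Real.log_div (by positivity) hpos.ne', Real.log_mul (by positivity) htpos.ne',
        Real.log_div hXpos.ne' hTpos.ne'] at hl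
      have := mul_le_mul_of_nonneg_left hl hpos.le
      have e : x j * (X / T * t j / x j - 1) = X / T * t j - x j := by field_simp
      rw [e] at this
      rw [Real.negMulLog]
      linarith
  refine (Finset.sum_le_sum key).trans (le_of_eq ?_)
  rw [Finset.sum_add_distrib, Finset.sum_sub_distrib, ← Finset.sum_mul, ← Finset.mul_sum, ← hX,
    ← hT, div_mul_cancel₀ _ hTpos.ne', Real.negMulLog]
  ring

variable {H H' : Type*} [Fintype H] [DecidableEq H] [Fintype H'] [DecidableEq H']

/-- The unnormalized entropy `-Tr M log (M / Tr M)` (in nats), homogeneous of degree one. -/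
def unnormalizedEntropy (M : Matrix H H ℂ) : ℝ :=
  spectralSum (fun x => Real.negMulLog x + x * Real.log M.trace.re) M

theorem concaveOn_negMulLog_add_mul (c : ℝ) :
    ConcaveOn ℝ (Set.Ici 0) fun x => Real.negMulLog x + x * c := by
  refine Real.concaveOn_negMulLog.add ⟨convex_Ici 0, ?_⟩
  intro x _ y _ p q _ _ _
  simp only [smul_eq_mul]
  exact le_of_eq (by ring)

/-- Concavity of entropy in homogeneous form. In an eigenbasis of the sum, Peierls' inequality
bounds each term by its diagonal. The log sum inequality then adds these bounds for each basis
vector, where the total is already diagonal. -/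
theorem sum_unnormalizedEntropy_le {J : Type*} [Fintype J] {M : J → Matrix H H ℂ}
    (hM : ∀ j, (M j).PosSemidef) :
    ∑ j, unnormalizedEntropy (M j) ≤ unnormalizedEntropy (∑ j, M j) := by
  have hS : (∑ j, M j).PosSemidef := Matrix.posSemidef_sum _ fun j _ => hM j
  obtain ⟨U, hU, hU', hSU⟩ := exists_spectral_decomposition hS.isHermitian
  have hdiag : ∀ j i, 0 ≤ ((Uᴴ * M j * U) i i).re := fun j i =>
    (Complex.le_def.1 ((hM j).conjTranspose_mul_mul_same U).diag_nonneg).1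
  have htr : ∀ j, (M j).trace.re = ∑ i, ((Uᴴ * M j * U) i i).re := by
    intro j
    rw [← Complex.re_sum]
    change _ = (Matrix.trace (Uᴴ * M j * U)).re
    rw [Matrix.trace_mul_cycle, hU, Matrix.one_mul]
  have heig : ∀ i, hS.isHermitian.eigenvalues i = ∑ j, ((Uᴴ * M j * U) i i).re := by
    intro i
    have : ∑ j, Uᴴ * M j * U = Matrix.diagonal fun i => (hS.isHermitian.eigenvalues i : ℂ) := by
      rw [← Finset.sum_mul, ← Finset.mul_sum]
      conv_lhs => rw [hSU]
      rw [Matrix.mul_assoc, Matrix.mul_assoc, hU', Matrix.mul_one, ← Matrix.mul_assoc, hU',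
        Matrix.one_mul]
    have h2 := congrArg Complex.re (congrFun (congrFun this i) i)
    rw [Matrix.sum_apply, Complex.re_sum, Matrix.diagonal_apply_eq, Complex.ofReal_re] at h2
    exact h2.symm
  calc ∑ j, unnormalizedEntropy (M j)
      ≤ ∑ j, ∑ i, (Real.negMulLog ((Uᴴ * M j * U) i i).re +
          ((Uᴴ * M j * U) i i).re * Real.log (M j).trace.re) :=
        Finset.sum_le_sum fun j _ =>
          spectralSum_le_sum_diag (concaveOn_negMulLog_add_mul _) (hM j) hU hU'
    _ = ∑ i, ∑ j, (Real.negMulLog ((Uᴴ * M j * U) i i).re +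
          ((Uᴴ * M j * U) i i).re * Real.log (M j).trace.re) := Finset.sum_comm
    _ ≤ ∑ i, (Real.negMulLog (hS.isHermitian.eigenvalues i) +
          hS.isHermitian.eigenvalues i * Real.log (∑ j, M j).trace.re) := by
        refine Finset.sum_le_sum fun i _ => ?_
        rw [heig, Matrix.trace_sum, Complex.re_sum]
        refine log_sum_inequality _ _ _ (fun j _ => hdiag j i) fun j _ => ?_
        rw [htr j]
        exact Finset.single_le_sum (f := fun i => ((Uᴴ * M j * U) i i).re)
          (fun k _ => hdiag j k) (Finset.mem_univ i)
    _ = unnormalizedEntropy (∑ j, M j) :=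
        (spectralSum_eq_sum_eigenvalues
          (fun x => Real.negMulLog x + x * Real.log (∑ j, M j).trace.re) hS.isHermitian).symm

theorem unnormalizedEntropy_mul_comm (A : Matrix H H' ℂ) (B : Matrix H' H ℂ) :
    unnormalizedEntropy (A * B) = unnormalizedEntropy (B * A) := by
  rw [unnormalizedEntropy, unnormalizedEntropy, Matrix.trace_mul_comm A B]
  exact spectralSum_mul_comm (by simp) A B

theorem unnormalizedEntropy_nonneg {M : Matrix H H ℂ} (hM : M.PosSemidef) :
    0 ≤ unnormalizedEntropy M := by
  rw [unnormalizedEntropy, spectralSum_eq_sum_eigenvalues _ hM.isHermitian,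
    trace_re_eq_sum_eigenvalues hM.isHermitian]
  refine Finset.sum_nonneg fun i _ => ?_
  have h0 := hM.eigenvalues_nonneg i
  have hle : hM.isHermitian.eigenvalues i ≤ ∑ i, hM.isHermitian.eigenvalues i :=
    Finset.single_le_sum (fun k _ => hM.eigenvalues_nonneg k) (Finset.mem_univ i)
  rcases h0.eq_or_lt with h | h
  · simp [← h]
  · have := mul_le_mul_of_nonneg_left (Real.log_le_log h hle) h0
    rw [Real.negMulLog]
    linarith

/-- The two `log c` contributions cancel, which is the purpose of the trace term. -/
theorem unnormalizedEntropy_smul {M : Matrix H H ℂ} (hM : M.PosSemidef) {c : ℝ} (hc : 0 ≤ c) :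
    unnormalizedEntropy ((c : ℂ) • M) = c * unnormalizedEntropy M := by
  rcases hc.eq_or_lt with rfl | hc
  · rw [unnormalizedEntropy, spectralSum_smul _ hM.isHermitian,
      spectralSum_eq_sum_eigenvalues _ hM.isHermitian]
    simp
  rw [unnormalizedEntropy, unnormalizedEntropy, spectralSum_smul _ hM.isHermitian,
    spectralSum_eq_sum_eigenvalues _ hM.isHermitian,
    spectralSum_eq_sum_eigenvalues _ hM.isHermitian, Finset.mul_sum, Matrix.trace_smul, smul_eq_mul,
    Complex.re_ofReal_mul, trace_re_eq_sum_eigenvalues hM.isHermitian]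
  refine Finset.sum_congr rfl fun i _ => ?_
  have h0 := hM.eigenvalues_nonneg i
  have hle : hM.isHermitian.eigenvalues i ≤ ∑ i, hM.isHermitian.eigenvalues i :=
    Finset.single_le_sum (fun k _ => hM.eigenvalues_nonneg k) (Finset.mem_univ i)
  rcases h0.eq_or_lt with h | h
  · simp [← h]
  · rw [Real.negMulLog, Real.negMulLog, Real.log_mul hc.ne' h.ne',
      Real.log_mul hc.ne' (h.trans_le hle).ne']
    ring

end Superadditivity

/-! ### Unnormalized vectors and their entanglement -/

section Vectors

variable {H : Type*} [Fintype H]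

theorem normSq_nonneg (φ : H → ℂ) : 0 ≤ normSq φ :=
  Finset.sum_nonneg fun _ _ => by positivity

theorem eq_zero_of_normSq_eq_zero {φ : H → ℂ} (h : normSq φ = 0) : φ = 0 := by
  funext i
  have := (Finset.sum_eq_zero_iff_of_nonneg fun _ _ => by positivity).1 h i (Finset.mem_univ i)
  simpa using this

theorem normSq_smul (c : ℂ) (φ : H → ℂ) : normSq (c • φ) = Complex.normSq c * normSq φ := by
  simp [normSq, mul_pow, Finset.mul_sum, Complex.normSq_eq_norm_sq]

theorem normSq_normalize {φ : H → ℂ} (h : normSq φ ≠ 0) :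
    normSq (((Real.sqrt (normSq φ) : ℂ))⁻¹ • φ) = 1 := by
  rw [normSq_smul, map_inv₀, Complex.normSq_ofReal, Real.mul_self_sqrt (normSq_nonneg φ),
    inv_mul_cancel₀ h]

theorem trace_ketbra (φ : H → ℂ) : (ketbra φ).trace = (normSq φ : ℂ) := by
  simp only [Matrix.trace, ketbra, Matrix.diag_apply, Matrix.vecMulVec_apply, Pi.star_apply,
    RCLike.star_def, normSq, Complex.ofReal_sum, Complex.mul_conj, Complex.normSq_eq_norm_sq]

theorem ketbra_smul (c : ℂ) (φ : H → ℂ) :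
    ketbra (c • φ) = (Complex.normSq c : ℂ) • ketbra φ := by
  ext i j
  simp only [ketbra, Matrix.vecMulVec_apply, Pi.smul_apply, Pi.star_apply, smul_eq_mul, star_mul',
    Matrix.smul_apply, RCLike.star_def, ← Complex.mul_conj]
  ring

theorem ketbra_mulVec {H' : Type*} (M : Matrix H' H ℂ) (φ : H → ℂ) :
    ketbra (M *ᵥ φ) = M * ketbra φ * Mᴴ := by
  rw [ketbra, ketbra, Matrix.star_mulVec, Matrix.mul_vecMulVec, Matrix.vecMulVec_mul]

theorem posSemidef_ketbra (φ : H → ℂ) : (ketbra φ).PosSemidef :=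
  Matrix.posSemidef_vecMulVec_self_star φ

end Vectors

section Entanglement

variable {a b : Type*} [Fintype a] [DecidableEq a] [Fintype b] [DecidableEq b]

theorem trace_coeff (φ : a × b → ℂ) :
    (coeff φ * (coeff φ)ᴴ).trace = (normSq φ : ℂ) := by
  rw [← trace_ketbra]
  simp [Matrix.trace, Matrix.mul_apply, coeff, ketbra, Matrix.vecMulVec_apply,
    Fintype.sum_prod_type]

theorem coeff_smul (c : ℂ) (φ : a × b → ℂ) : coeff (c • φ) = c • coeff φ := rfl

theorem coeff_smul_mul_conjTranspose (c : ℂ) (φ : a × b → ℂ) :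
    coeff (c • φ) * (coeff (c • φ))ᴴ =
      ((Complex.normSq c : ℝ) : ℂ) • (coeff φ * (coeff φ)ᴴ) := by
  rw [coeff_smul, Matrix.conjTranspose_smul, Matrix.smul_mul, Matrix.mul_smul, smul_smul,
    RCLike.star_def, Complex.mul_conj]

theorem coeff_kronecker_mulVec (K : Matrix a a ℂ) (L : Matrix b b ℂ) (φ : a × b → ℂ) :
    coeff ((K ⊗ₖ L) *ᵥ φ) = K * coeff φ * Lᵀ := by
  ext i j
  simp only [coeff, Matrix.of_apply, Matrix.mulVec, dotProduct, Matrix.mul_apply,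
    Matrix.kroneckerMap_apply, Fintype.sum_prod_type, Matrix.transpose_apply, Finset.sum_mul]
  rw [Finset.sum_comm]
  exact Finset.sum_congr rfl fun _ _ => Finset.sum_congr rfl fun _ _ => by ring

theorem pureEntanglement_eq_unnormalizedEntropy {ψ : a × b → ℂ} (h : normSq ψ = 1) :
    pureEntanglement ψ = unnormalizedEntropy (coeff ψ * (coeff ψ)ᴴ) / Real.log 2 := by
  rw [pureEntanglement, entropy_eq_spectralSum, unnormalizedEntropy, trace_coeff, h]
  simp

/-- The entanglement of an unnormalized vector: squared norm times the entropy of entanglement of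
the normalized vector. -/
def entWeight (φ : a × b → ℂ) : ℝ :=
  normSq φ * pureEntanglement (((Real.sqrt (normSq φ) : ℂ))⁻¹ • φ)

/-- Both sides are homogeneous of degree one in |φ|². The right side involves no normalization, so
zero vectors need no separate care later. -/
theorem entWeight_eq (φ : a × b → ℂ) :
    entWeight φ = unnormalizedEntropy (coeff φ * (coeff φ)ᴴ) / Real.log 2 := by
  have hA : (coeff φ * (coeff φ)ᴴ).PosSemidef := Matrix.posSemidef_self_mul_conjTranspose _
  by_cases h : normSq φ = 0
  · have h0 : coeff φ = 0 := by rw [eq_zero_of_normSq_eq_zero h]; rfl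
    have h1 := unnormalizedEntropy_smul (Matrix.PosSemidef.zero (n := a) (R := ℂ)) le_rfl
    rw [smul_zero, zero_mul] at h1
    rw [entWeight, h, h0, Matrix.zero_mul, h1]
    simp
  · rw [entWeight, pureEntanglement_eq_unnormalizedEntropy (normSq_normalize h),
      coeff_smul_mul_conjTranspose, unnormalizedEntropy_smul hA (Complex.normSq_nonneg _), map_inv₀,
      Complex.normSq_ofReal, Real.mul_self_sqrt (normSq_nonneg φ)]
    field_simp

theorem entWeight_nonneg (φ : a × b → ℂ) : 0 ≤ entWeight φ := by
  rw [entWeight_eq]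
  exact div_nonneg (unnormalizedEntropy_nonneg (Matrix.posSemidef_self_mul_conjTranspose _))
    (Real.log_nonneg one_le_two)

theorem entWeight_of_normSq_eq_one {φ : a × b → ℂ} (h : normSq φ = 1) :
    entWeight φ = pureEntanglement φ := by
  simp [entWeight, h]

theorem entWeight_smul (c : ℂ) (φ : a × b → ℂ) :
    entWeight (c • φ) = Complex.normSq c * entWeight φ := by
  rw [entWeight_eq, entWeight_eq, coeff_smul_mul_conjTranspose,
    unnormalizedEntropy_smul (Matrix.posSemidef_self_mul_conjTranspose _)
      (Complex.normSq_nonneg _), mul_div_assoc]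

theorem entWeight_zero : entWeight (0 : a × b → ℂ) = 0 := by
  simpa using entWeight_smul 0 (0 : a × b → ℂ)

/-- Bob's operators act on the coefficient matrix from the right, so Alice's reduced operators add
up to `coeff φ * (coeff φ)ᴴ`, and superadditivity applies. -/
theorem sum_entWeight_right_le {J : Type*} [Fintype J] {L : J → Matrix b b ℂ}
    (hL : ∑ j, (L j)ᴴ * L j = 1) (φ : a × b → ℂ) :
    ∑ j, entWeight (((1 : Matrix a a ℂ) ⊗ₖ L j) *ᵥ φ) ≤ entWeight φ := by
  simp only [entWeight_eq, ← Finset.sum_div]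
  refine div_le_div_of_nonneg_right ?_ (Real.log_nonneg one_le_two)
  refine (sum_unnormalizedEntropy_le fun j =>
    Matrix.posSemidef_self_mul_conjTranspose _).trans (le_of_eq ?_)
  congr 1
  have hT : ∑ j, (L j)ᵀ * ((L j)ᵀ)ᴴ = 1 := by
    rw [← Matrix.transpose_one, ← hL, Matrix.transpose_sum]
    refine Finset.sum_congr rfl fun j _ => ?_
    rw [Matrix.transpose_mul]
    rfl
  simp only [coeff_kronecker_mulVec, Matrix.one_mul, Matrix.conjTranspose_mul]
  calc ∑ j, coeff φ * (L j)ᵀ * (((L j)ᵀ)ᴴ * (coeff φ)ᴴ)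
      = coeff φ * (∑ j, (L j)ᵀ * ((L j)ᵀ)ᴴ) * (coeff φ)ᴴ := by
        simp only [Matrix.mul_sum, Matrix.sum_mul, Matrix.mul_assoc]
    _ = coeff φ * (coeff φ)ᴴ := by rw [hT, Matrix.mul_one]

/-- Alice's operators do not preserve the sum of the `A * Aᴴ`, but they preserve that of the `Aᴴ *
A`, which have the same unnormalized entropy. -/
theorem sum_entWeight_left_le {J : Type*} [Fintype J] {K : J → Matrix a a ℂ}
    (hK : ∑ j, (K j)ᴴ * K j = 1) (φ : a × b → ℂ) :
    ∑ j, entWeight ((K j ⊗ₖ (1 : Matrix b b ℂ)) *ᵥ φ) ≤ entWeight φ := by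
  simp only [entWeight_eq, ← Finset.sum_div]
  refine div_le_div_of_nonneg_right ?_ (Real.log_nonneg one_le_two)
  simp only [unnormalizedEntropy_mul_comm (coeff _)]
  refine (sum_unnormalizedEntropy_le fun j =>
    Matrix.posSemidef_conjTranspose_mul_self _).trans (le_of_eq ?_)
  congr 1
  simp only [coeff_kronecker_mulVec, Matrix.transpose_one, Matrix.mul_one,
    Matrix.conjTranspose_mul]
  calc ∑ j, (coeff φ)ᴴ * (K j)ᴴ * (K j * coeff φ)
      = (coeff φ)ᴴ * (∑ j, (K j)ᴴ * K j) * coeff φ := by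
        simp only [Matrix.mul_sum, Matrix.sum_mul, Matrix.mul_assoc]
    _ = (coeff φ)ᴴ * coeff φ := by rw [hK, Matrix.mul_one]

/-- Local measurements do not increase the average entanglement of a pure state. -/
theorem sum_entWeight_kronecker_le {I J : Type*} [Fintype I] [Fintype J] {K : I → Matrix a a ℂ}
    {L : J → Matrix b b ℂ} (hK : ∑ i, (K i)ᴴ * K i = 1) (hL : ∑ j, (L j)ᴴ * L j = 1)
    (φ : a × b → ℂ) :
    ∑ i, ∑ j, entWeight ((K i ⊗ₖ L j) *ᵥ φ) ≤ entWeight φ := by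
  refine (Finset.sum_le_sum fun i _ => ?_).trans (sum_entWeight_left_le hK φ)
  refine le_trans (le_of_eq ?_) (sum_entWeight_right_le hL _)
  refine Finset.sum_congr rfl fun j _ => ?_
  rw [Matrix.mulVec_mulVec, ← Matrix.mul_kronecker_mul, Matrix.one_mul, Matrix.mul_one]

/-! ### Entanglement of formation through unnormalized decompositions -/

/-- The values over which the infimum in the entanglement of formation is taken. -/
def formationCosts (ρ : Matrix (a × b) (a × b) ℂ) : Set ℝ :=
  {e : ℝ | ∃ (k : ℕ) (p : Fin k → ℝ) (ψ : Fin k → a × b → ℂ),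
    (∀ i, 0 ≤ p i) ∧ ∑ i, p i = 1 ∧ (∀ i, normSq (ψ i) = 1) ∧
    ρ = ∑ i, (p i : ℂ) • ketbra (ψ i) ∧
    e = ∑ i, p i * pureEntanglement (ψ i)}

/-- The weights are absorbed into the vectors as √p; the cost follows by homogeneity. -/
theorem exists_decomposition_of_mem_formationCosts {ρ : Matrix (a × b) (a × b) ℂ} {e : ℝ}
    (he : e ∈ formationCosts ρ) :
    ∃ (k : ℕ) (φ : Fin k → a × b → ℂ), ρ = ∑ i, ketbra (φ i) ∧ e = ∑ i, entWeight (φ i) := by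
  obtain ⟨k, p, ψ, hp, -, hψ, hρ, rfl⟩ := he
  have hn : ∀ i, Complex.normSq ((Real.sqrt (p i) : ℝ) : ℂ) = p i := fun i => by
    rw [Complex.normSq_ofReal, Real.mul_self_sqrt (hp i)]
  refine ⟨k, fun i => ((Real.sqrt (p i) : ℝ) : ℂ) • ψ i, ?_, ?_⟩
  · rw [hρ]
    simp only [ketbra_smul, hn]
  · simp only [entWeight_smul, hn, entWeight_of_normSq_eq_one (hψ _)]

theorem formationCosts_nonneg {ρ : Matrix (a × b) (a × b) ℂ} {e : ℝ} (he : e ∈ formationCosts ρ) :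
    0 ≤ e := by
  obtain ⟨k, φ, -, rfl⟩ := exists_decomposition_of_mem_formationCosts he
  exact Finset.sum_nonneg fun i _ => entWeight_nonneg _

theorem entanglementOfFormation_nonneg (ρ : Matrix (a × b) (a × b) ℂ) :
    0 ≤ entanglementOfFormation ρ :=
  Real.sInf_nonneg fun _ he => formationCosts_nonneg he

theorem sum_entWeight_mem_formationCosts {ι : Type*} [Fintype ι] {ρ : Matrix (a × b) (a × b) ℂ}
    (hρ : ρ.trace = 1) {φ : ι → a × b → ℂ} (h : ρ = ∑ i, ketbra (φ i)) :
    ∑ i, entWeight (φ i) ∈ formationCosts ρ := by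
  have hne : Nonempty (a × b) := by
    by_contra hc
    rw [not_nonempty_iff] at hc
    simp [Matrix.trace] at hρ
  obtain ⟨v⟩ := hne
  let e := Fintype.equivFin ι
  -- A zero vector cannot be normalized; an arbitrary unit vector replaces it, with weight 0.
  let ψ : ι → a × b → ℂ := fun i =>
    if normSq (φ i) = 0 then Pi.single v 1 else ((Real.sqrt (normSq (φ i)) : ℂ))⁻¹ • φ i
  have hψ : ∀ i, normSq (ψ i) = 1 := by
    intro i
    by_cases h0 : normSq (φ i) = 0
    · simp only [ψ, if_pos h0]
      rw [normSq, Finset.sum_eq_single v] <;> simp +contextual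
    · simp only [ψ, if_neg h0]
      exact normSq_normalize h0
  have hk : ∀ i, (normSq (φ i) : ℂ) • ketbra (ψ i) = ketbra (φ i) := by
    intro i
    by_cases h0 : normSq (φ i) = 0
    · rw [h0, eq_zero_of_normSq_eq_zero h0]
      simp [ketbra]
    · simp only [ψ, if_neg h0]
      rw [ketbra_smul, smul_smul, map_inv₀, Complex.normSq_ofReal,
        Real.mul_self_sqrt (normSq_nonneg _), ← Complex.ofReal_mul, mul_inv_cancel₀ h0,
        Complex.ofReal_one, one_smul]
  have hE : ∀ i, normSq (φ i) * pureEntanglement (ψ i) = entWeight (φ i) := by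
    intro i
    by_cases h0 : normSq (φ i) = 0
    · simp [entWeight, h0]
    · simp only [ψ, if_neg h0, entWeight]
  refine ⟨Fintype.card ι, fun i => normSq (φ (e.symm i)), fun i => ψ (e.symm i),
    fun i => normSq_nonneg _, ?_, fun i => hψ _, ?_, ?_⟩
  · rw [e.symm.sum_comp fun i => normSq (φ i)]
    rw [h, Matrix.trace_sum] at hρ
    simp only [trace_ketbra] at hρ
    exact_mod_cast hρ
  · simp only [hk]
    rw [e.symm.sum_comp fun i => ketbra (φ i), h]
  · simp only [hE]
    rw [e.symm.sum_comp fun i => entWeight (φ i)]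

theorem entanglementOfFormation_le {ι : Type*} [Fintype ι] {ρ : Matrix (a × b) (a × b) ℂ}
    (hρ : ρ.trace = 1) {φ : ι → a × b → ℂ} (h : ρ = ∑ i, ketbra (φ i)) :
    entanglementOfFormation ρ ≤ ∑ i, entWeight (φ i) :=
  csInf_le ⟨0, fun _ he => formationCosts_nonneg he⟩ (sum_entWeight_mem_formationCosts hρ h)

/-- Guards against the default value 0 of `sInf` on the empty set. -/
theorem formationCosts_nonempty {ρ : Matrix (a × b) (a × b) ℂ} (hρ : IsState ρ) :
    (formationCosts ρ).Nonempty := by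
  obtain ⟨m, v, hv⟩ := Matrix.posSemidef_iff_eq_sum_vecMulVec.1 hρ.1
  exact ⟨_, sum_entWeight_mem_formationCosts hρ.2 hv⟩

theorem le_entanglementOfFormation {ρ : Matrix (a × b) (a × b) ℂ} (hρ : IsState ρ) {c : ℝ}
    (h : ∀ (k : ℕ) (φ : Fin k → a × b → ℂ), ρ = ∑ i, ketbra (φ i) →
      c ≤ ∑ i, entWeight (φ i)) :
    c ≤ entanglementOfFormation ρ := by
  refine le_csInf (formationCosts_nonempty hρ) fun e he => ?_
  obtain ⟨k, φ, hφ, rfl⟩ := exists_decomposition_of_mem_formationCosts he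
  exact h k φ hφ

theorem exists_decomposition_lt {ρ : Matrix (a × b) (a × b) ℂ} (hρ : IsState ρ) {ε : ℝ}
    (hε : 0 < ε) :
    ∃ (k : ℕ) (φ : Fin k → a × b → ℂ), ρ = ∑ i, ketbra (φ i) ∧
      ∑ i, entWeight (φ i) < entanglementOfFormation ρ + ε := by
  obtain ⟨e, he, hlt⟩ := exists_lt_of_csInf_lt (formationCosts_nonempty hρ)
    (lt_add_of_pos_right (sInf (formationCosts ρ)) hε)
  obtain ⟨k, φ, hφ, rfl⟩ := exists_decomposition_of_mem_formationCosts he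
  exact ⟨k, φ, hφ, hlt⟩

/-- All pure-state decompositions of a pure state have the same average entanglement. -/
theorem sum_entWeight_eq_of_ketbra_eq {ι : Type*} [Fintype ι] {ψ : a × b → ℂ}
    {φ : ι → a × b → ℂ} (h : ketbra ψ = ∑ i, ketbra (φ i)) :
    ∑ i, entWeight (φ i) = entWeight ψ := by
  by_cases h0 : normSq ψ = 0
  · have htr := congrArg Matrix.trace h
    rw [Matrix.trace_sum] at htr
    simp only [trace_ketbra, h0] at htr
    have hs : ∑ i, normSq (φ i) = 0 := by exact_mod_cast htr.symm
    have hz := (Finset.sum_eq_zero_iff_of_nonneg fun i _ => normSq_nonneg (φ i)).1 hs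
    rw [eq_zero_of_normSq_eq_zero h0, entWeight_zero]
    refine Finset.sum_eq_zero fun i hi => ?_
    rw [eq_zero_of_normSq_eq_zero (hz i hi), entWeight_zero]
  -- The decomposition is compared through quadratic forms.
  have hform : ∀ x : a × b → ℂ, Complex.normSq (star x ⬝ᵥ ψ) =
      ∑ i, Complex.normSq (star x ⬝ᵥ φ i) := by
    intro x
    have hq : ∀ y : a × b → ℂ,
        star x ⬝ᵥ (ketbra y *ᵥ x) = (Complex.normSq (star x ⬝ᵥ y) : ℂ) := by
      intro y
      rw [ketbra, Matrix.vecMulVec_mulVec, op_smul_eq_smul, dotProduct_smul, smul_eq_mul, mul_comm,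
        ← Complex.mul_conj]
      rw [← RCLike.star_def, ← Matrix.star_dotProduct]
    have := congrArg (fun M => star x ⬝ᵥ (M *ᵥ x)) h
    simp only [Matrix.sum_mulVec, dotProduct_sum, hq] at this
    exact_mod_cast this
  set t := star ψ ⬝ᵥ ψ with ht
  have htn : t = (normSq ψ : ℂ) := by
    rw [← trace_ketbra, ketbra, Matrix.trace_vecMulVec, dotProduct_comm]
  have ht0 : t ≠ 0 := by rw [htn]; exact_mod_cast h0
  -- Let x be the part of φ i orthogonal to ψ. The form of ψ vanishes at x, hence so does each
  -- summand; thus x is orthogonal to φ i and to ψ, hence to itself.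
  have hprop : ∀ i, φ i = ((star ψ ⬝ᵥ φ i) / t) • ψ := by
    intro i
    set c := (star ψ ⬝ᵥ φ i) / t with hc
    set x := φ i - c • ψ with hx
    have hxψ : star ψ ⬝ᵥ x = 0 := by
      rw [hx, dotProduct_sub, dotProduct_smul, smul_eq_mul, ← ht, hc, div_mul_cancel₀ _ ht0,
        sub_self]
    have hψx : star x ⬝ᵥ ψ = 0 := by
      rw [Matrix.star_dotProduct, hxψ, star_zero]
    have hz := hform x
    rw [hψx, map_zero] at hz
    have hz2 := (Finset.sum_eq_zero_iff_of_nonneg fun i _ => Complex.normSq_nonneg _).1 hz.symm i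
      (Finset.mem_univ i)
    rw [Complex.normSq_eq_zero] at hz2
    have hxx : star x ⬝ᵥ x = 0 := by
      conv_lhs => rw [hx]
      rw [← hx, dotProduct_sub, dotProduct_smul, hψx, hz2, smul_zero, sub_zero]
    rw [← sub_eq_zero]
    exact dotProduct_star_self_eq_zero.1 hxx
  have hsum : ∑ i, Complex.normSq ((star ψ ⬝ᵥ φ i) / t) = 1 := by
    simp only [map_div₀, ← Finset.sum_div]
    rw [← hform ψ, ← ht, div_self]
    rwa [Ne, Complex.normSq_eq_zero]
  calc ∑ i, entWeight (φ i)
      = ∑ i, Complex.normSq ((star ψ ⬝ᵥ φ i) / t) * entWeight ψ :=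
        Finset.sum_congr rfl fun i _ => by
          conv_lhs => rw [hprop i]
          exact entWeight_smul _ _
    _ = entWeight ψ := by rw [← Finset.sum_mul, hsum, one_mul]

theorem entanglementOfFormation_ketbra {ψ : a × b → ℂ} (h : normSq ψ = 1) :
    entanglementOfFormation (ketbra ψ) = entWeight ψ := by
  have htr : (ketbra ψ).trace = 1 := by rw [trace_ketbra, h, Complex.ofReal_one]
  refine le_antisymm ?_ ?_
  · simpa using entanglementOfFormation_le (ι := Unit) htr (φ := fun _ => ψ) (by simp)
  · exact le_entanglementOfFormation ⟨posSemidef_ketbra ψ, htr⟩ fun k φ hφ =>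
      (sum_entWeight_eq_of_ketbra_eq hφ).ge

/-- Convexity of the entanglement of formation. -/
theorem entanglementOfFormation_sum_le {J : Type*} {s : Finset J} {p : J → ℝ}
    {τ : J → Matrix (a × b) (a × b) ℂ} {ρ : Matrix (a × b) (a × b) ℂ} (hρ : ρ.trace = 1)
    (hp : ∀ j ∈ s, 0 ≤ p j) (hsum : ∑ j ∈ s, p j = 1) (hτ : ∀ j ∈ s, p j ≠ 0 → IsState (τ j))
    (h : ρ = ∑ j ∈ s, (p j : ℂ) • τ j) :
    entanglementOfFormation ρ ≤ ∑ j ∈ s, p j * entanglementOfFormation (τ j) := by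
  refine le_of_forall_pos_le_add fun ε hε => ?_
  -- Near-optimal decompositions with error p j * ε, which adds up to ε. Where p j = 0, τ j need not
  -- be a state, and the empty decomposition is taken.
  have hdec : ∀ j : s, ∃ (k : ℕ) (φ : Fin k → a × b → ℂ),
      (p j : ℂ) • τ j = ∑ i, ketbra (φ i) ∧
      ∑ i, entWeight (φ i) ≤ p j * entanglementOfFormation (τ j) + p j * ε := by
    intro j
    by_cases h0 : p j = 0
    · exact ⟨0, Fin.elim0, by simp [h0], by simp [h0]⟩
    · obtain ⟨k, φ, hφ, hlt⟩ := exists_decomposition_lt (hτ j j.2 h0) hε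
      have hn : Complex.normSq ((Real.sqrt (p j) : ℝ) : ℂ) = p j := by
        rw [Complex.normSq_ofReal, Real.mul_self_sqrt (hp j j.2)]
      refine ⟨k, fun i => ((Real.sqrt (p j) : ℝ) : ℂ) • φ i, ?_, ?_⟩
      · simp only [ketbra_smul, hn, ← Finset.smul_sum, ← hφ]
      · simp only [entWeight_smul, hn, ← Finset.mul_sum, ← mul_add]
        exact mul_le_mul_of_nonneg_left hlt.le (hp j j.2)
  choose k φ hφ hle using hdec
  have hρφ : ρ = ∑ x : (Σ j : s, Fin (k j)), ketbra (φ x.1 x.2) := by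
    rw [Fintype.sum_sigma, h, ← Finset.sum_coe_sort s]
    exact Finset.sum_congr rfl fun j _ => hφ j
  refine (entanglementOfFormation_le hρ hρφ).trans ?_
  rw [Fintype.sum_sigma]
  refine (Finset.sum_le_sum fun j _ => hle j).trans (le_of_eq ?_)
  rw [Finset.sum_coe_sort s fun j => p j * entanglementOfFormation (τ j) + p j * ε,
    Finset.sum_add_distrib, ← Finset.sum_mul, hsum, one_mul]

end Entanglement

/-! ### Pinching maps -/

section Pinch

variable {H C : Type*} [Fintype H] [DecidableEq H] [DecidableEq C]

/-- The pinching of `M` to the blocks of constant `f`. -/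
def pinch (f : H → C) (M : Matrix H H ℂ) : Matrix H H ℂ :=
  Matrix.of fun i j => if f i = f j then M i j else 0

theorem pinch_apply (f : H → C) (M : Matrix H H ℂ) (i j : H) :
    pinch f M i j = if f i = f j then M i j else 0 := rfl

/-- The projector onto the block `f = c`. -/
def blockProj (f : H → C) (c : C) : Matrix H H ℂ :=
  Matrix.diagonal fun i => if f i = c then 1 else 0

theorem conjTranspose_blockProj (f : H → C) (c : C) : (blockProj f c)ᴴ = blockProj f c := by
  rw [blockProj, Matrix.diagonal_conjTranspose]
  congr 1
  ext i
  simp [apply_ite]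

theorem blockProj_mul_mul_apply (f : H → C) (c : C) (M : Matrix H H ℂ) (i j : H) :
    (blockProj f c * M * blockProj f c) i j = if f i = c ∧ f j = c then M i j else 0 := by
  rw [blockProj, Matrix.mul_diagonal, Matrix.diagonal_mul]
  by_cases h1 : f i = c <;> by_cases h2 : f j = c <;> simp [h1, h2]

theorem sum_blockProj (f : H → C) {s : Finset C} (hs : ∀ i, f i ∈ s) (M : Matrix H H ℂ) :
    ∑ c ∈ s, blockProj f c * M * blockProj f c = pinch f M := by
  ext i j
  simp only [Matrix.sum_apply, blockProj_mul_mul_apply, pinch, Matrix.of_apply]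
  by_cases h : f i = f j
  · rw [if_pos h, Finset.sum_eq_single (f i)]
    · simp [h]
    · intro c _ hc
      rw [if_neg fun h' => hc h'.1.symm]
    · exact fun h' => absurd (hs i) h'
  · rw [if_neg h]
    exact Finset.sum_eq_zero fun c _ => if_neg fun h' => h (h'.1.trans h'.2.symm)

theorem krausMap_blockProj (f : H → C) {s : Finset C} (hs : ∀ i, f i ∈ s) (M : Matrix H H ℂ) :
    krausMap s (blockProj f) M = pinch f M := by
  simp only [krausMap, conjTranspose_blockProj, sum_blockProj f hs]

theorem krausDual_blockProj (f : H → C) {s : Finset C} (hs : ∀ i, f i ∈ s) (M : Matrix H H ℂ) :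
    krausDual s (blockProj f) M = pinch f M := by
  simp only [krausDual, conjTranspose_blockProj, sum_blockProj f hs]

theorem posSemidef_pinch (f : H → C) {M : Matrix H H ℂ} (hM : M.PosSemidef) :
    (pinch f M).PosSemidef := by
  rw [← sum_blockProj f (s := Finset.univ.image f) (by simp) M]
  refine Matrix.posSemidef_sum _ fun c _ => ?_
  have := hM.conjTranspose_mul_mul_same (blockProj f c)
  rwa [conjTranspose_blockProj] at this

theorem trace_pinch (f : H → C) (M : Matrix H H ℂ) : (pinch f M).trace = M.trace := by
  simp [Matrix.trace, pinch]

theorem pinch_one (f : H → C) : pinch f (1 : Matrix H H ℂ) = 1 := by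
  ext i j
  by_cases h : i = j
  · subst h
    simp [pinch]
  · simp [pinch, Matrix.one_apply_ne h]

theorem pinch_pinch (f : H → C) (M : Matrix H H ℂ) : pinch f (pinch f M) = pinch f M := by
  ext i j
  by_cases h : f i = f j <;> simp [pinch, h]

theorem pinch_sum {ι : Type*} (f : H → C) (s : Finset ι) (M : ι → Matrix H H ℂ) :
    pinch f (∑ x ∈ s, M x) = ∑ x ∈ s, pinch f (M x) := by
  ext i j
  by_cases h : f i = f j <;> simp [pinch, h, Matrix.sum_apply]

/-- Self-adjointness of the pinching, which moves the restriction from measurements to states. -/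
theorem trace_pinch_mul (f : H → C) (M N : Matrix H H ℂ) :
    (pinch f M * N).trace = (M * pinch f N).trace := by
  simp only [Matrix.trace, Matrix.diag_apply, Matrix.mul_apply, pinch, Matrix.of_apply]
  refine Finset.sum_congr rfl fun i _ => Finset.sum_congr rfl fun j _ => ?_
  by_cases h : f i = f j
  · simp [h]
  · simp [h, Ne.symm h]

theorem isState_pinch (f : H → C) {M : Matrix H H ℂ} (hM : IsState M) : IsState (pinch f M) :=
  ⟨posSemidef_pinch f hM.1, (trace_pinch f M).trans hM.2⟩

theorem isPOVM_pinch (f : H → C) {X : Type*} [Fintype X] {P : X → Matrix H H ℂ} (hP : IsPOVM P) :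
    IsPOVM fun x => pinch f (P x) :=
  ⟨fun x => posSemidef_pinch f (hP.1 x), by rw [← pinch_sum, hP.2, pinch_one]⟩

theorem pinch_kronecker {H' C' : Type*} [DecidableEq C'] (f : H → C) (g : H' → C')
    (M : Matrix H H ℂ) (N : Matrix H' H' ℂ) :
    pinch f M ⊗ₖ pinch g N = pinch (fun v : H × H' => (f v.1, g v.2)) (M ⊗ₖ N) := by
  ext v w
  by_cases h1 : f v.1 = f w.1 <;> by_cases h2 : g v.2 = g w.2 <;>
    simp [pinch, Matrix.kroneckerMap_apply, h1, h2]

end Pinch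

/-! ### Effective measurements -/

section EffectiveOp

variable {a A₀ : Type u} {C : Type*} [Fintype a] [DecidableEq a] [Fintype A₀] [DecidableEq A₀]

theorem effectiveOp_apply (M : Matrix (A₀ × a) (A₀ × a) ℂ) (ζ : Matrix A₀ A₀ ℂ) (i j : a) :
    effectiveOp M ζ i j = ∑ k, ∑ k', M (k, i) (k', j) * ζ k' k := by
  simp [effectiveOp, Matrix.mul_apply, Fintype.sum_prod_type, Matrix.one_apply]

/-- The label depends on the share only, so tracing out the question does not interfere. -/
theorem effectiveOp_pinch [DecidableEq C] (f : a → C) (M : Matrix (A₀ × a) (A₀ × a) ℂ)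
    (ζ : Matrix A₀ A₀ ℂ) :
    effectiveOp (pinch (fun v => f v.2) M) ζ = pinch f (effectiveOp M ζ) := by
  ext i j
  rw [effectiveOp_apply, pinch_apply, effectiveOp_apply]
  by_cases h : f i = f j <;> simp [pinch_apply, h]

theorem effectiveOp_one (ζ : Matrix A₀ A₀ ℂ) :
    effectiveOp (1 : Matrix (A₀ × a) (A₀ × a) ℂ) ζ = ζ.trace • (1 : Matrix a a ℂ) := by
  ext i j
  rw [effectiveOp_apply]
  by_cases h : i = j
  · simp [h, Matrix.one_apply, Matrix.trace]
  · simp [h]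

theorem effectiveOp_sum {X : Type*} [Fintype X] (P : X → Matrix (A₀ × a) (A₀ × a) ℂ)
    (ζ : Matrix A₀ A₀ ℂ) : effectiveOp (∑ x, P x) ζ = ∑ x, effectiveOp (P x) ζ := by
  ext i j
  simp only [effectiveOp_apply, Matrix.sum_apply, Finset.sum_mul]
  refine Eq.trans ?_ Finset.sum_comm
  exact Finset.sum_congr rfl fun k _ => Finset.sum_comm

/-- With ζ a sum of rank-one terms |z⟩⟨z|, the partial trace is a sum of `Zᴴ * M * Z`, where Z is z
⊗ 1. -/
theorem posSemidef_effectiveOp {M : Matrix (A₀ × a) (A₀ × a) ℂ} (hM : M.PosSemidef)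
    {ζ : Matrix A₀ A₀ ℂ} (hζ : ζ.PosSemidef) : (effectiveOp M ζ).PosSemidef := by
  obtain ⟨m, z, rfl⟩ := Matrix.posSemidef_iff_eq_sum_vecMulVec.1 hζ
  let Z : Fin m → Matrix (A₀ × a) a ℂ := fun l =>
    Matrix.of fun v j => if v.2 = j then z l v.1 else 0
  have : effectiveOp M (∑ l, Matrix.vecMulVec (z l) (star (z l))) =
      ∑ l, (Z l)ᴴ * M * Z l := by
    ext i j
    rw [effectiveOp_apply]
    simp only [Matrix.sum_apply, Matrix.mul_apply, Z, Matrix.conjTranspose_apply, Matrix.of_apply,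
      Fintype.sum_prod_type, Matrix.vecMulVec_apply, Pi.star_apply, apply_ite star, star_zero,
      ite_mul, zero_mul, mul_ite, mul_zero, Finset.sum_ite_eq', Finset.mem_univ, if_true,
      Finset.mul_sum, Finset.sum_mul]
    rw [Finset.sum_comm]
    refine Eq.trans ?_ Finset.sum_comm
    refine Finset.sum_congr rfl fun k _ => ?_
    rw [Finset.sum_comm]
    exact Finset.sum_congr rfl fun l _ => Finset.sum_congr rfl fun k' _ => by ring
  rw [this]
  exact Matrix.posSemidef_sum _ fun l _ => hM.conjTranspose_mul_mul_same _

theorem isPOVM_effectiveOp {X : Type*} [Fintype X] {P : X → Matrix (A₀ × a) (A₀ × a) ℂ}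
    (hP : IsPOVM P) {ζ : Matrix A₀ A₀ ℂ} (hζ : IsState ζ) :
    IsPOVM fun x => effectiveOp (P x) ζ :=
  ⟨fun x => posSemidef_effectiveOp (hP.1 x) hζ.1, by
    rw [← effectiveOp_sum, hP.2, effectiveOp_one, hζ.2, one_smul]⟩

theorem isPOVM_kronecker {H H' X Y : Type*} [Fintype H] [DecidableEq H] [Fintype H']
    [DecidableEq H'] [Fintype X] [Fintype Y] {P : X → Matrix H H ℂ} {Q : Y → Matrix H' H' ℂ}
    (hP : IsPOVM P) (hQ : IsPOVM Q) : IsPOVM fun o : X × Y => P o.1 ⊗ₖ Q o.2 := by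
  refine ⟨fun o => (hP.1 o.1).kronecker (hQ.1 o.2), ?_⟩
  rw [← Matrix.one_kronecker_one, ← hP.2, ← hQ.2]
  ext v w
  simp only [Matrix.sum_apply, Matrix.kroneckerMap_apply, Fintype.sum_prod_type,
    Finset.sum_mul_sum]

end EffectiveOp

/-! ### Restricted payoffs are payoffs of the pinched state -/

section Games

variable {a b S T X Y A₀ B₀ : Type u} [Fintype a] [DecidableEq a] [Fintype b] [DecidableEq b]
  [Fintype S] [Fintype T] [Fintype X] [Fintype Y]
  [Fintype A₀] [DecidableEq A₀] [Fintype B₀] [DecidableEq B₀]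

/-- Tracing out the questions first shows that a strategy matters only through its effective
operators. -/
theorem trace_kronecker_mul_jointState (P : Matrix (A₀ × a) (A₀ × a) ℂ)
    (Q : Matrix (B₀ × b) (B₀ × b) ℂ) (ζ : Matrix A₀ A₀ ℂ) (η : Matrix B₀ B₀ ℂ)
    (ρ : Matrix (a × b) (a × b) ℂ) :
    ((P ⊗ₖ Q) * jointState ζ ρ η).trace =
      ((effectiveOp P ζ ⊗ₖ effectiveOp Q η) * ρ).trace := by
  have hL : ((P ⊗ₖ Q) * jointState ζ ρ η).trace =
      ∑ v : (A₀ × a) × (B₀ × b), ∑ w : (A₀ × a) × (B₀ × b),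
        P v.1 w.1 * Q v.2 w.2 *
          (ζ w.1.1 v.1.1 * ρ (w.1.2, w.2.2) (v.1.2, v.2.2) * η w.2.1 v.2.1) := rfl
  have hR : ((effectiveOp P ζ ⊗ₖ effectiveOp Q η) * ρ).trace =
      ∑ v : a × b, ∑ w : a × b, effectiveOp P ζ v.1 w.1 * effectiveOp Q η v.2 w.2 * ρ w v := rfl
  rw [hL, hR]
  let e : ((a × b) × (A₀ × B₀)) ≃ ((A₀ × a) × (B₀ × b)) :=
    { toFun := fun v => ((v.2.1, v.1.1), (v.2.2, v.1.2))
      invFun := fun v => ((v.1.2, v.2.2), (v.1.1, v.2.1))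
      left_inv := fun _ => rfl
      right_inv := fun _ => rfl }
  simp only [← e.sum_comp]
  rw [Fintype.sum_prod_type]
  refine Finset.sum_congr rfl fun v _ => ?_
  simp only [Fintype.sum_prod_type (f := fun w : (a × b) × (A₀ × B₀) => _)]
  rw [Finset.sum_comm]
  refine Finset.sum_congr rfl fun w _ => ?_
  rw [effectiveOp_apply, effectiveOp_apply, Finset.sum_mul_sum, Fintype.sum_prod_type,
    Finset.sum_mul]
  simp only [Fintype.sum_prod_type, e, Equiv.coe_fn_mk, Finset.sum_mul, Finset.mul_sum]
  refine Finset.sum_congr rfl fun k _ => Finset.sum_congr rfl fun l _ => ?_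
  rw [Finset.sum_comm]
  exact Finset.sum_congr rfl fun k' _ => Finset.sum_congr rfl fun l' _ => by ring

theorem outcomeProb_eq (G : Game S T X Y A₀ B₀) (ρ : Matrix (a × b) (a × b) ℂ)
    (P : X → Matrix (A₀ × a) (A₀ × a) ℂ) (Q : Y → Matrix (B₀ × b) (B₀ × b) ℂ)
    (s : S) (t : T) (x : X) (y : Y) :
    outcomeProb G ρ P Q s t x y =
      ((effectiveOp (P x) (G.ζ s) ⊗ₖ effectiveOp (Q y) (G.η t)) * ρ).trace.re := by
  rw [outcomeProb, trace_kronecker_mul_jointState]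

variable {κ C C' : Type*} [DecidableEq C] [DecidableEq C']

/-- The two sets of payoffs coincide. A restricted effective operator is fixed by the pinching,
which can be moved onto ρ. Conversely, pinching the shares in any strategy makes it admissible, and
its payoff on ρ is that of the original strategy on the pinched state. -/
theorem restrictedPayoff_eq_payoff_pinch {k : Finset κ} {K : κ → Matrix (a × b) (a × b) ℂ}
    {fA : a → C} {fB : b → C'}
    (hK : ∀ M, krausDual k K M = pinch (fun v : a × b => (fA v.1, fB v.2)) M)
    (G : Game S T X Y A₀ B₀) (ρ : Matrix (a × b) (a × b) ℂ) :
    restrictedPayoff k K G ρ = payoff G (pinch (fun v : a × b => (fA v.1, fB v.2)) ρ) := by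
  refine congrArg sSup (Set.ext fun r => ⟨?_, ?_⟩)
  · rintro ⟨P, Q, hP, hQ, hPQ, rfl⟩
    refine ⟨P, Q, hP, hQ, ?_⟩
    simp only [averagePayoff, outcomeProb_eq]
    refine Finset.sum_congr rfl fun s _ => Finset.sum_congr rfl fun t _ =>
      Finset.sum_congr rfl fun x _ => Finset.sum_congr rfl fun y _ => ?_
    obtain ⟨F₀, -, hF₀⟩ := hPQ s t
    have h := hF₀ (x, y)
    dsimp only at h
    rw [hK] at h
    rw [← trace_pinch_mul, h, pinch_pinch]
  · rintro ⟨P, Q, hP, hQ, rfl⟩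
    refine ⟨fun x => pinch (fun v => fA v.2) (P x), fun y => pinch (fun v => fB v.2) (Q y),
      isPOVM_pinch _ hP, isPOVM_pinch _ hQ, fun s t => ?_, ?_⟩
    · have hF := isPOVM_kronecker (isPOVM_effectiveOp hP (G.ζ_state s))
        (isPOVM_effectiveOp hQ (G.η_state t))
      refine ⟨_, hF, fun o => ?_⟩
      dsimp only
      rw [hK, effectiveOp_pinch, effectiveOp_pinch, pinch_kronecker]
    · simp only [averagePayoff, outcomeProb_eq, effectiveOp_pinch, pinch_kronecker,
        trace_pinch_mul]

end Games

/-! ### Compactness -/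

section Compactness

/-- By Carathéodory, finrank + 1 points suffice, so the hull is a continuous image of a simplex
times a power of s. -/
theorem isCompact_convexHull {E : Type*} [NormedAddCommGroup E] [NormedSpace ℝ E]
    [FiniteDimensional ℝ E] {s : Set E} (hs : IsCompact s) : IsCompact (convexHull ℝ s) := by
  rcases s.eq_empty_or_nonempty with rfl | ⟨z₀, hz₀⟩
  · simp
  let n := Module.finrank ℝ E + 1
  have himage : convexHull ℝ s = (fun q : (Fin n → ℝ) × (Fin n → E) => ∑ i, q.1 i • q.2 i) ''
      (stdSimplex ℝ (Fin n) ×ˢ Set.pi Set.univ fun _ => s) := by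
    refine Set.Subset.antisymm ?_ ?_
    · intro x hx
      obtain ⟨ι, _, z, w, hz, hind, hw, hw1, rfl⟩ := eq_pos_convex_span_of_mem_convexHull hx
      have hcard : Fintype.card ι ≤ Fintype.card (Fin n) := by
        rw [Fintype.card_fin]
        exact hind.card_le_finrank_succ.trans (Nat.succ_le_succ (Submodule.finrank_le _))
      obtain ⟨e⟩ := Function.Embedding.nonempty_of_card_le hcard
      -- Shorter combinations are padded with weight 0 at the point z₀.
      have hext : ∀ i, Function.extend e w 0 (e i) = w i := e.injective.extend_apply w 0
      have hext' : ∀ i, i ∉ Set.range e → Function.extend e w 0 i = 0 := fun i hi => by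
        rw [Function.extend_apply' _ _ _ hi, Pi.zero_apply]
      refine ⟨(Function.extend e w 0, Function.extend e z fun _ => z₀), ⟨⟨fun i => ?_, ?_⟩, ?_⟩, ?_⟩
      · by_cases hi : i ∈ Set.range e
        · obtain ⟨j, rfl⟩ := hi
          exact (hw j).le.trans_eq (hext j).symm
        · exact (hext' i hi).ge
      · rw [← hw1]
        exact (Fintype.sum_of_injective e e.injective _ _ hext' fun i => (hext i).symm).symm
      · intro i _
        by_cases hi : i ∈ Set.range e
        · obtain ⟨j, rfl⟩ := hi
          dsimp only
          rw [e.injective.extend_apply]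
          exact hz (Set.mem_range_self j)
        · dsimp only
          rw [Function.extend_apply' _ _ _ hi]
          exact hz₀
      · refine (Fintype.sum_of_injective e e.injective _ _ (fun i hi => ?_) fun i => ?_).symm
        · dsimp only
          rw [hext' i hi, zero_smul]
        · dsimp only
          rw [hext, e.injective.extend_apply]
    · rintro _ ⟨⟨w, z⟩, ⟨⟨hw, hw1⟩, hz⟩, rfl⟩
      exact mem_convexHull_of_exists_fintype w z hw hw1 (fun i => hz i (Set.mem_univ i)) rfl
  rw [himage]
  refine ((isCompact_stdSimplex ℝ (Fin n)).prod (isCompact_univ_pi fun _ => hs)).image ?_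
  fun_prop

variable {H : Type*} [Fintype H] [DecidableEq H]

theorem isClosed_posSemidef : IsClosed {M : Matrix H H ℂ | M.PosSemidef} := by
  simp only [Matrix.posSemidef_iff_dotProduct_mulVec, Set.ofPred_and, Set.ofPred_forall]
  refine IsClosed.inter ?_ (isClosed_iInter fun x => ?_)
  · exact isClosed_eq (Continuous.matrix_conjTranspose continuous_id) continuous_id
  · refine isClosed_le continuous_const ?_
    exact Continuous.dotProduct continuous_const (Continuous.matrix_mulVec continuous_id
      continuous_const)

/-- Arithmetic–geometric mean on each rank-one term. It confines the entries of a POVM to the unit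
disc, since its diagonal entries are at most 1. -/
theorem norm_apply_le_of_posSemidef {M : Matrix H H ℂ} (hM : M.PosSemidef) (i j : H) :
    ‖M i j‖ ≤ ((M i i).re + (M j j).re) / 2 := by
  obtain ⟨m, v, rfl⟩ := Matrix.posSemidef_iff_eq_sum_vecMulVec.1 hM
  have hdiag : ∀ i, ((∑ l, Matrix.vecMulVec (v l) (star (v l))) i i).re = ∑ l, ‖v l i‖ ^ 2 := by
    intro i
    rw [Matrix.sum_apply, Complex.re_sum]
    refine Finset.sum_congr rfl fun l _ => ?_
    rw [Matrix.vecMulVec_apply, Pi.star_apply, RCLike.star_def, Complex.mul_conj,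
      Complex.ofReal_re, Complex.normSq_eq_norm_sq]
  rw [hdiag, hdiag, ← Finset.sum_add_distrib, Finset.sum_div, Matrix.sum_apply]
  refine norm_sum_le_of_le _ fun l _ => ?_
  rw [Matrix.vecMulVec_apply, norm_mul, Pi.star_apply, norm_star]
  nlinarith [sq_nonneg (‖v l i‖ - ‖v l j‖)]

theorem isCompact_isPOVM {X : Type*} [Fintype X] :
    IsCompact {P : X → Matrix H H ℂ | IsPOVM P} := by
  have hcl : IsClosed {P : X → Matrix H H ℂ | IsPOVM P} := by
    simp only [IsPOVM, Set.ofPred_and, Set.ofPred_forall]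
    refine IsClosed.inter (isClosed_iInter fun x => ?_) ?_
    · exact (isClosed_posSemidef (H := H)).preimage
        (f := fun P : X → Matrix H H ℂ => P x) (continuous_apply x)
    · exact isClosed_eq (continuous_finsetSum _ fun x _ => continuous_apply x) continuous_const
  have hbox : IsCompact (Set.pi Set.univ fun _ : X => Set.pi Set.univ fun _ : H =>
      Set.pi Set.univ fun _ : H => Metric.closedBall (0 : ℂ) 1) :=
    isCompact_univ_pi fun _ => isCompact_univ_pi fun _ => isCompact_univ_pi fun _ =>
      isCompact_closedBall _ _
  refine IsCompact.of_isClosed_subset hbox hcl fun P hP x _ i _ j _ => ?_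
  have hd : ∀ i, (P x i i).re ≤ 1 := by
    intro i
    have h := congrArg Complex.re (congrFun (congrFun hP.2 i) i)
    rw [Matrix.sum_apply, Complex.re_sum, Matrix.one_apply_eq, Complex.one_re] at h
    rw [← h]
    exact Finset.single_le_sum (f := fun x => (P x i i).re)
      (fun y _ => (Complex.le_def.1 (hP.1 y).diag_nonneg).1) (Finset.mem_univ x)
  rw [mem_closedBall_zero_iff]
  refine (norm_apply_le_of_posSemidef (hP.1 x) i j).trans ?_
  linarith [hd i, hd j]

end Compactness

/-! ### Simulation of correlations with shared randomness -/

section Simulation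

variable {a b S T X Y A₀ B₀ : Type u} [Fintype a] [DecidableEq a] [Fintype b] [DecidableEq b]
  [Fintype S] [Fintype T] [Fintype X] [Fintype Y]
  [Fintype A₀] [DecidableEq A₀] [Fintype B₀] [DecidableEq B₀]

/-- The correlation generated by local measurements on the questions and a shared state. -/
def correlation (ζ : S → Matrix A₀ A₀ ℂ) (η : T → Matrix B₀ B₀ ℂ)
    (ρ : Matrix (a × b) (a × b) ℂ)
    (PQ : (X → Matrix (A₀ × a) (A₀ × a) ℂ) × (Y → Matrix (B₀ × b) (B₀ × b) ℂ)) :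
    S × T × X × Y → ℝ := fun z =>
  ((PQ.1 z.2.2.1 ⊗ₖ PQ.2 z.2.2.2) * jointState (ζ z.1) ρ (η z.2.1)).trace.re

theorem continuous_correlation (ζ : S → Matrix A₀ A₀ ℂ) (η : T → Matrix B₀ B₀ ℂ)
    (ρ : Matrix (a × b) (a × b) ℂ) : Continuous (correlation (X := X) (Y := Y) ζ η ρ) := by
  refine continuous_pi fun z => Complex.continuous_re.comp ?_
  refine Continuous.matrix_trace (Continuous.matrix_mul ?_ continuous_const)
  refine continuous_matrix fun v w => ?_
  simp only [Matrix.kroneckerMap_apply]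
  exact (((continuous_apply z.2.2.1).comp continuous_fst).matrix_elem _ _).mul
    (((continuous_apply z.2.2.2).comp continuous_snd).matrix_elem _ _)

theorem isCompact_correlations (ζ : S → Matrix A₀ A₀ ℂ) (η : T → Matrix B₀ B₀ ℂ)
    (ρ : Matrix (a × b) (a × b) ℂ) :
    IsCompact (correlation (X := X) (Y := Y) ζ η ρ '' ({P | IsPOVM P} ×ˢ {Q | IsPOVM Q})) :=
  (isCompact_isPOVM.prod isCompact_isPOVM).image (continuous_correlation ζ η ρ)

/-- If `σ` performs at least as well as `τ` in all games with questions `ζ`, `η`, then every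
correlation of `τ` is a convex combination of correlations of `σ`. -/
theorem correlation_mem_convexHull [Nonempty S] [Nonempty T] {ζ : S → Matrix A₀ A₀ ℂ}
    {η : T → Matrix B₀ B₀ ℂ} (hζ : ∀ s, IsState (ζ s)) (hη : ∀ t, IsState (η t))
    {σ τ : Matrix (a × b) (a × b) ℂ}
    (h : ∀ G : Game S T X Y A₀ B₀, payoff G τ ≤ payoff G σ)
    {P₀ : X → Matrix (A₀ × a) (A₀ × a) ℂ} {Q₀ : Y → Matrix (B₀ × b) (B₀ × b) ℂ}
    (hP₀ : IsPOVM P₀) (hQ₀ : IsPOVM Q₀) :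
    correlation ζ η τ (P₀, Q₀) ∈
      convexHull ℝ (correlation (X := X) (Y := Y) ζ η σ '' ({P | IsPOVM P} ×ˢ {Q | IsPOVM Q})) := by
  classical
  by_contra hc
  -- A functional separating the correlation of τ from the compact hull for σ is turned into a game.
  obtain ⟨f, c, hf, hfc⟩ := geometric_hahn_banach_closed_point (convex_convexHull ℝ _)
    (isCompact_convexHull (isCompact_correlations ζ η σ)).isClosed hc
  have hS : (Fintype.card S : ℝ) ≠ 0 := Nat.cast_ne_zero.2 Fintype.card_ne_zero
  have hT : (Fintype.card T : ℝ) ≠ 0 := Nat.cast_ne_zero.2 Fintype.card_ne_zero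
  -- Questions are uniform; the factors card S and card T in the payoff cancel their probabilities,
  -- so the average payoff is exactly f.
  let G : Game S T X Y A₀ B₀ :=
    { p := fun _ => (Fintype.card S : ℝ)⁻¹
      q := fun _ => (Fintype.card T : ℝ)⁻¹
      p_nonneg := fun _ => by positivity
      q_nonneg := fun _ => by positivity
      p_sum := by simp
      q_sum := by simp
      ζ := ζ
      η := η
      ζ_state := hζ
      η_state := hη
      pay := fun s t x y =>
        Fintype.card S * Fintype.card T * f (Pi.single (s, t, x, y) 1) }
  have hG : ∀ (ρ : Matrix (a × b) (a × b) ℂ) P Q,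
      averagePayoff G ρ P Q = f (correlation ζ η ρ (P, Q)) := by
    intro ρ P Q
    have := LinearMap.pi_apply_eq_sum_univ f.toLinearMap (correlation ζ η ρ (P, Q))
    rw [ContinuousLinearMap.coe_coe] at this
    rw [this]
    simp only [averagePayoff, Fintype.sum_prod_type, G]
    refine Finset.sum_congr rfl fun s _ => Finset.sum_congr rfl fun t _ =>
      Finset.sum_congr rfl fun x _ => Finset.sum_congr rfl fun y _ => ?_
    have e : (fun j : S × T × X × Y => if (s, t, x, y) = j then (1 : ℝ) else 0) =
        Pi.single (s, t, x, y) 1 := by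
      ext j
      simp [Pi.single_apply, eq_comm]
    rw [e, smul_eq_mul]
    change _ * _ * _ * correlation ζ η ρ (P, Q) (s, t, x, y) = _
    field_simp
  have hσ : payoff G σ ≤ c := by
    refine csSup_le ⟨_, P₀, Q₀, hP₀, hQ₀, rfl⟩ ?_
    rintro r ⟨P, Q, hP, hQ, rfl⟩
    rw [hG]
    exact (hf _ (subset_convexHull ℝ _ ⟨(P, Q), ⟨hP, hQ⟩, rfl⟩)).le
  -- The supremum is genuine because compactness bounds the payoffs.
  have hτ : averagePayoff G τ P₀ Q₀ ≤ payoff G τ := by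
    refine le_csSup ?_ ⟨P₀, Q₀, hP₀, hQ₀, rfl⟩
    have hb := ((isCompact_correlations (X := X) (Y := Y) ζ η τ).image f.continuous).bddAbove
    refine hb.mono ?_
    rintro r ⟨P, Q, hP, hQ, rfl⟩
    rw [hG]
    exact ⟨_, ⟨(P, Q), ⟨hP, hQ⟩, rfl⟩, rfl⟩
  rw [hG] at hτ
  exact absurd (hfc.trans_le (hτ.trans ((h G).trans hσ))) (lt_irrefl _)

end Simulation

/-! ### Informationally complete states and unitary designs -/

section Designs

variable (a : Type u) [Fintype a] [DecidableEq a] [Nonempty a]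

/-- Polarization: the normalized vectors e_i + c e_j with c = 1 or I suffice. The case i = j kills
the diagonal of C; the two values of c then kill C i j and C j i. -/
theorem exists_informationallyComplete :
    ∃ (S : Type u) (_ : Fintype S) (_ : Nonempty S) (ζ : S → Matrix a a ℂ),
      (∀ s, IsState (ζ s)) ∧
      ∀ C : Matrix a a ℂ, (∀ s, ∑ k, ∑ k', ζ s k' k * C k' k = 0) → C = 0 := by
  let c : ULift.{u} Bool → ℂ := fun z => if z.down then 1 else Complex.I
  let v : (a × a) × ULift.{u} Bool → a → ℂ := fun s =>
    Pi.single s.1.1 1 + c s.2 • Pi.single s.1.2 1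
  have hv : ∀ s, normSq (v s) ≠ 0 := by
    rintro ⟨⟨i, j⟩, z⟩ h
    have h0 := congrFun (eq_zero_of_normSq_eq_zero h) i
    simp only [v, c, Pi.add_apply, Pi.single_eq_same, Pi.smul_apply, Pi.zero_apply,
      smul_eq_mul] at h0
    have h1 := congrArg Complex.re h0
    by_cases hij : i = j
    · subst hij
      by_cases hz : z.down <;> simp [hz] at h1
    · simp [Pi.single_eq_of_ne hij] at h1
  refine ⟨(a × a) × ULift.{u} Bool, inferInstance, inferInstance,
    fun s => (((normSq (v s))⁻¹ : ℝ) : ℂ) • ketbra (v s), fun s => ⟨?_, ?_⟩, ?_⟩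
  · exact (posSemidef_ketbra _).smul
      (Complex.zero_le_real.2 (inv_nonneg.2 (normSq_nonneg (v s))))
  · rw [Matrix.trace_smul, trace_ketbra, smul_eq_mul, ← Complex.ofReal_mul,
      inv_mul_cancel₀ (hv s), Complex.ofReal_one]
  · intro C hC
    have key : ∀ i j z,
        C i i + star (c z) * C i j + c z * (C j i + star (c z) * C j j) = 0 := by
      intro i j z
      have h := hC ((i, j), z)
      simp only [Matrix.smul_apply, smul_eq_mul, mul_assoc, ← Finset.mul_sum] at h
      have h2 := (mul_eq_zero.1 h).resolve_left
        (Complex.ofReal_ne_zero.2 (inv_ne_zero (hv _)))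
      rw [← h2, Finset.sum_comm]
      simp only [ketbra, Matrix.vecMulVec_apply, v, Pi.add_apply, Pi.smul_apply, smul_eq_mul,
        Pi.star_apply, star_add, add_mul, mul_add, Finset.sum_add_distrib,
        Pi.single_apply, apply_ite star, star_one, star_zero, ite_mul, mul_ite, mul_one, mul_zero,
        zero_mul, one_mul, Finset.sum_ite_eq', Finset.mem_univ, if_true]
      ring
    have hd : ∀ i, C i i = 0 := by
      intro i
      have h := key i i ⟨true⟩
      simp only [c, if_true, star_one, one_mul] at h
      linear_combination h / 4
    ext i j
    have h1 := key i j ⟨true⟩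
    have h2 := key i j ⟨false⟩
    simp only [c, if_true, star_one, one_mul, hd, Bool.false_eq_true, if_false, RCLike.star_def,
      Complex.conj_I] at h1 h2
    rw [Matrix.zero_apply]
    linear_combination h1 / 2 + Complex.I * h2 / 2 + (C i j - C j i) / 2 * Complex.I_sq

/-- For i ≠ j, flipping the sign at i is an involution that negates the summand. -/
theorem sum_sign_mul_sign (i j : a) :
    ∑ ε : a → Bool, ((if ε i then 1 else -1 : ℂ) * if ε j then 1 else -1) =
      if i = j then 2 ^ Fintype.card a else 0 := by
  split_ifs with h
  · subst h
    rw [Finset.sum_congr rfl fun ε _ => show ((if ε i then 1 else -1 : ℂ) *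
      if ε i then 1 else -1) = 1 by by_cases h : ε i <;> simp [h]]
    simp
  · let F : (a → Bool) → (a → Bool) := fun ε => Function.update ε i (!ε i)
    have hF : Function.Involutive F := fun ε => by simp [F]
    have hs := Equiv.sum_comp hF.toPerm
      fun ε : a → Bool => ((if ε i then 1 else -1 : ℂ) * if ε j then 1 else -1)
    have hneg : ∀ ε : a → Bool, ((if F ε i then 1 else -1 : ℂ) * if F ε j then 1 else -1) =
        -((if ε i then 1 else -1 : ℂ) * if ε j then 1 else -1) := by
      intro ε
      simp only [F, Function.update_self, Function.update_of_ne (Ne.symm h)]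
      by_cases h1 : ε i <;> by_cases h2 : ε j <;> simp [h1, h2]
    exact self_eq_neg.1 (hs.symm.trans ((Finset.sum_congr rfl fun ε _ => hneg ε).trans
      (Finset.sum_neg_distrib _)))

/-- Translations of a group structure on the index set, combined with sign changes: e_i goes to ±
e_{g+i}. Averaging over signs forces i = i', after which both entries survive only if k = k', for
the single translation g = k - i. The weight w cancels the number of sign patterns. -/
theorem exists_unitaryDesign :
    ∃ (X : Type u) (_ : Fintype X) (_ : Nonempty X) (U : X → Matrix a a ℂ) (w : ℝ), 0 ≤ w ∧
      (∀ x, (U x)ᴴ * U x = 1) ∧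
      ∀ k i k' i', ∑ x, (w : ℂ) * (star (U x k i) * U x k' i') =
        if k = k' ∧ i = i' then 1 else 0 := by
  have : NeZero (Fintype.card a) := ⟨Fintype.card_ne_zero⟩
  let _ : AddCommGroup a := (Fintype.equivFin a).addCommGroup
  let U : a × (a → Bool) → Matrix a a ℂ := fun x =>
    Matrix.of fun k i => if k = x.1 + i then (if x.2 i then 1 else -1) else 0
  refine ⟨a × (a → Bool), inferInstance, inferInstance, U, ((2 : ℝ) ^ Fintype.card a)⁻¹,
    by positivity, fun x => ?_, fun k i k' i' => ?_⟩
  · ext i j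
    simp only [Matrix.mul_apply, Matrix.conjTranspose_apply, U, Matrix.of_apply, apply_ite star,
      star_zero, star_one, star_neg, ite_mul, zero_mul, Finset.sum_ite_eq', Finset.mem_univ,
      if_true, add_right_inj]
    by_cases h : i = j
    · subst h
      by_cases h' : x.2 i <;> simp [h']
    · simp [h]
  · rw [← Finset.mul_sum, Fintype.sum_prod_type]
    have hstep : ∀ g : a, ∑ ε : a → Bool, star (U (g, ε) k i) * U (g, ε) k' i' =
        if g = k - i then (if k = k' ∧ i = i' then 2 ^ Fintype.card a else 0) else 0 := by
      intro g
      have hU : ∀ ε : a → Bool, star (U (g, ε) k i) * U (g, ε) k' i' =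
          (if k = g + i ∧ k' = g + i' then 1 else 0) *
            ((if ε i then 1 else -1 : ℂ) * if ε i' then 1 else -1) := by
        intro ε
        by_cases h1 : k = g + i <;> by_cases h2 : k' = g + i' <;> by_cases h3 : ε i <;>
          simp [U, h1, h2, h3]
      simp only [hU, ← Finset.mul_sum, sum_sign_mul_sign]
      by_cases hi : i = i'
      · subst hi
        by_cases hg : g = k - i
        · subst hg
          simp [eq_comm]
        · have : ¬ k = g + i := fun h => hg (by rw [h, add_sub_cancel_right])
          simp [hg, this]
      · simp [hi]
    simp only [hstep, Finset.sum_ite_eq', Finset.mem_univ, if_true]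
    split_ifs <;> simp

end Designs

/-! ### The operators generated on the question spaces -/

section OutputOp

variable {a b A₀ B₀ : Type u} [Fintype a] [DecidableEq a] [Fintype b] [DecidableEq b]
  [Fintype A₀] [DecidableEq A₀] [Fintype B₀] [DecidableEq B₀]

/-- The operator on the question spaces, up to transposition, that gives the probability of a pair
of measurement operators `P`, `Q` as a function of the questions. -/
def outputOp (P : Matrix (A₀ × a) (A₀ × a) ℂ) (Q : Matrix (B₀ × b) (B₀ × b) ℂ)
    (σ : Matrix (a × b) (a × b) ℂ) : Matrix (A₀ × B₀) (A₀ × B₀) ℂ :=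
  Matrix.of fun z' z => ∑ v : a × b, ∑ w : a × b,
    P (z.1, v.1) (z'.1, w.1) * Q (z.2, v.2) (z'.2, w.2) * σ w v

/-- The evaluation of an operator on the question spaces at a pair of questions. -/
def questionValue (ζ : Matrix A₀ A₀ ℂ) (η : Matrix B₀ B₀ ℂ)
    (D : Matrix (A₀ × B₀) (A₀ × B₀) ℂ) : ℂ :=
  ∑ k, ∑ k', ζ k' k * ∑ l, ∑ l', η l' l * D (k', l') (k, l)

theorem trace_eq_questionValue (P : Matrix (A₀ × a) (A₀ × a) ℂ)
    (Q : Matrix (B₀ × b) (B₀ × b) ℂ) (ζ : Matrix A₀ A₀ ℂ) (η : Matrix B₀ B₀ ℂ)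
    (σ : Matrix (a × b) (a × b) ℂ) :
    ((P ⊗ₖ Q) * jointState ζ σ η).trace = questionValue ζ η (outputOp P Q σ) := by
  have hL : ((P ⊗ₖ Q) * jointState ζ σ η).trace =
      ∑ v : (A₀ × a) × (B₀ × b), ∑ w : (A₀ × a) × (B₀ × b),
        P v.1 w.1 * Q v.2 w.2 *
          (ζ w.1.1 v.1.1 * σ (w.1.2, w.2.2) (v.1.2, v.2.2) * η w.2.1 v.2.1) := rfl
  let e : ((A₀ × B₀) × (a × b)) ≃ ((A₀ × a) × (B₀ × b)) :=
    { toFun := fun v => ((v.1.1, v.2.1), (v.1.2, v.2.2))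
      invFun := fun v => ((v.1.1, v.2.1), (v.1.2, v.2.2))
      left_inv := fun _ => rfl
      right_inv := fun _ => rfl }
  have hR : questionValue ζ η (outputOp P Q σ) =
      ∑ z : A₀ × B₀, ∑ z' : A₀ × B₀, ζ z'.1 z.1 * η z'.2 z.2 * outputOp P Q σ z' z := by
    simp only [questionValue, Fintype.sum_prod_type, Finset.mul_sum]
    refine Finset.sum_congr rfl fun k _ => ?_
    rw [Finset.sum_comm]
    exact Finset.sum_congr rfl fun l _ => Finset.sum_congr rfl fun k' _ =>
      Finset.sum_congr rfl fun l' _ => by ring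
  rw [hL, hR]
  simp only [← e.sum_comp]
  rw [Fintype.sum_prod_type]
  refine Finset.sum_congr rfl fun z _ => ?_
  simp only [Fintype.sum_prod_type (f := fun w : (A₀ × B₀) × (a × b) => _)]
  rw [Finset.sum_comm]
  refine Finset.sum_congr rfl fun z' _ => ?_
  rw [outputOp, Matrix.of_apply, Finset.mul_sum]
  refine Finset.sum_congr rfl fun v _ => ?_
  rw [Finset.mul_sum]
  refine Finset.sum_congr rfl fun w _ => ?_
  simp only [e, Equiv.coe_fn_mk]
  ring

theorem isHermitian_outputOp {P : Matrix (A₀ × a) (A₀ × a) ℂ} {Q : Matrix (B₀ × b) (B₀ × b) ℂ}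
    {σ : Matrix (a × b) (a × b) ℂ} (hP : P.IsHermitian) (hQ : Q.IsHermitian)
    (hσ : σ.IsHermitian) : (outputOp P Q σ).IsHermitian := by
  ext z z'
  simp only [Matrix.conjTranspose_apply, outputOp, Matrix.of_apply, star_sum, star_mul',
    hP.apply, hQ.apply, hσ.apply]
  exact Finset.sum_comm

theorem star_questionValue {ζ : Matrix A₀ A₀ ℂ} {η : Matrix B₀ B₀ ℂ}
    {D : Matrix (A₀ × B₀) (A₀ × B₀) ℂ} (hζ : ζ.IsHermitian) (hη : η.IsHermitian)
    (hD : D.IsHermitian) : star (questionValue ζ η D) = questionValue ζ η D := by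
  simp only [questionValue, star_sum, star_mul', hζ.apply, hη.apply, hD.apply]
  rw [Finset.sum_comm]
  refine Finset.sum_congr rfl fun k _ => Finset.sum_congr rfl fun k' _ => ?_
  rw [Finset.sum_comm]

theorem isLinearMap_questionValue (ζ : Matrix A₀ A₀ ℂ) (η : Matrix B₀ B₀ ℂ) :
    IsLinearMap ℂ (questionValue ζ η) where
  map_add D D' := by
    simp only [questionValue, Matrix.add_apply, mul_add, Finset.sum_add_distrib]
  map_smul c D := by
    simp only [questionValue, Matrix.smul_apply, smul_eq_mul, mul_left_comm _ c, ← Finset.mul_sum]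

theorem questionValue_sum_smul {ι : Type*} [Fintype ι] (ζ : Matrix A₀ A₀ ℂ)
    (η : Matrix B₀ B₀ ℂ) (c : ι → ℂ) (D : ι → Matrix (A₀ × B₀) (A₀ × B₀) ℂ) :
    questionValue ζ η (∑ i, c i • D i) = ∑ i, c i * questionValue ζ η (D i) := by
  have h := map_sum ((isLinearMap_questionValue ζ η).mk' _) (fun i => c i • D i) Finset.univ
  exact Eq.trans h (Finset.sum_congr rfl fun i _ =>
    (isLinearMap_questionValue ζ η).map_smul _ _)

/-- Local tomography: completeness on Alice's side, then on Bob's, removes the questions.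
Hermiticity makes the values real, so real parts are enough. -/
theorem eq_of_questionValue_re_eq {S T : Type*} {ζ : S → Matrix A₀ A₀ ℂ}
    {η : T → Matrix B₀ B₀ ℂ} (hζ : ∀ s, IsState (ζ s)) (hη : ∀ t, IsState (η t))
    (hζC : ∀ C : Matrix A₀ A₀ ℂ, (∀ s, ∑ k, ∑ k', ζ s k' k * C k' k = 0) → C = 0)
    (hηC : ∀ C : Matrix B₀ B₀ ℂ, (∀ t, ∑ k, ∑ k', η t k' k * C k' k = 0) → C = 0)
    {D D' : Matrix (A₀ × B₀) (A₀ × B₀) ℂ} (hD : D.IsHermitian) (hD' : D'.IsHermitian)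
    (h : ∀ s t, (questionValue (ζ s) (η t) D).re = (questionValue (ζ s) (η t) D').re) :
    D = D' := by
  have hzero : ∀ s t, questionValue (ζ s) (η t) (D - D') = 0 := by
    intro s t
    have hst := star_questionValue (hζ s).1.isHermitian (hη t).1.isHermitian (hD.sub hD')
    rw [RCLike.star_def, Complex.conj_eq_iff_real] at hst
    obtain ⟨r, hr⟩ := hst
    have hre := congrArg Complex.re ((isLinearMap_questionValue (ζ s) (η t)).map_sub D D')
    rw [Complex.sub_re, h, sub_self, hr, Complex.ofReal_re] at hre
    rw [hr, hre, Complex.ofReal_zero]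
  have h1 : ∀ t, (Matrix.of fun k' k => ∑ l, ∑ l', η t l' l * (D - D') (k', l') (k, l)) =
      (0 : Matrix A₀ A₀ ℂ) := fun t => hζC _ fun s => hzero s t
  have h2 : ∀ k' k, (Matrix.of fun l' l => (D - D') (k', l') (k, l)) = (0 : Matrix B₀ B₀ ℂ) :=
    fun k' k => hηC _ fun t => congrFun (congrFun (h1 t) k') k
  rw [← sub_eq_zero]
  ext ⟨k', l'⟩ ⟨k, l⟩
  exact congrFun (congrFun (h2 k' k) l') l

/-- The operator `ℂ^a → ℂ^A₀` given by a vector on the product. -/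
def krausOf (v : A₀ × a → ℂ) : Matrix A₀ a ℂ := Matrix.of fun k i => star (v (k, i))

/-- As in teleportation, a rank-one outcome acts as a Kraus operator from the shares to the question
spaces. -/
theorem outputOp_ketbra (v : A₀ × a → ℂ) (w : B₀ × b → ℂ) (σ : Matrix (a × b) (a × b) ℂ) :
    outputOp (ketbra v) (ketbra w) σ =
      (krausOf v ⊗ₖ krausOf w) * σ * (krausOf v ⊗ₖ krausOf w)ᴴ := by
  ext z' z
  simp only [outputOp, Matrix.of_apply, Matrix.mul_apply, Matrix.conjTranspose_apply,
    Matrix.kroneckerMap_apply, krausOf, ketbra, Matrix.vecMulVec_apply, Pi.star_apply,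
    Finset.sum_mul, star_mul', star_star]
  exact Finset.sum_congr rfl fun x _ => Finset.sum_congr rfl fun y _ => by ring

theorem isLinearMap_outputOp_left (Q : Matrix (B₀ × b) (B₀ × b) ℂ)
    (σ : Matrix (a × b) (a × b) ℂ) :
    IsLinearMap ℂ fun P : Matrix (A₀ × a) (A₀ × a) ℂ => outputOp P Q σ where
  map_add P P' := by
    ext z' z
    simp only [outputOp, Matrix.of_apply, Matrix.add_apply, add_mul, Finset.sum_add_distrib]
  map_smul c P := by
    ext z' z
    simp only [outputOp, Matrix.of_apply, Matrix.smul_apply, smul_eq_mul, mul_assoc,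
      ← Finset.mul_sum]

theorem isLinearMap_outputOp_right (P : Matrix (A₀ × a) (A₀ × a) ℂ)
    (σ : Matrix (a × b) (a × b) ℂ) :
    IsLinearMap ℂ fun Q : Matrix (B₀ × b) (B₀ × b) ℂ => outputOp P Q σ where
  map_add Q Q' := by
    ext z' z
    simp only [outputOp, Matrix.of_apply, Matrix.add_apply, add_mul, mul_add,
      Finset.sum_add_distrib]
  map_smul c Q := by
    ext z' z
    simp only [outputOp, Matrix.of_apply, Matrix.smul_apply, smul_eq_mul, mul_left_comm _ c,
      mul_assoc, ← Finset.mul_sum]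

theorem outputOp_sum {I J : Type*} [Fintype I] [Fintype J] (P : I → Matrix (A₀ × a) (A₀ × a) ℂ)
    (Q : J → Matrix (B₀ × b) (B₀ × b) ℂ) (σ : Matrix (a × b) (a × b) ℂ) :
    outputOp (∑ i, P i) (∑ j, Q j) σ = ∑ i, ∑ j, outputOp (P i) (Q j) σ := by
  have h := map_sum ((isLinearMap_outputOp_left (∑ j, Q j) σ).mk' _) P Finset.univ
  refine Eq.trans h (Finset.sum_congr rfl fun i _ => ?_)
  exact map_sum ((isLinearMap_outputOp_right (P i) σ).mk' _) Q Finset.univ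

/-- Each basis vector of the question space contributes one identity. This fixes the factor 1 /
√(card a) in `correctedKraus`. -/
theorem sum_krausOf {J : Type*} [Fintype J] {v : J → A₀ × a → ℂ}
    (h : ∑ j, ketbra (v j) = 1) :
    ∑ j, (krausOf (v j))ᴴ * krausOf (v j) = (Fintype.card A₀ : ℂ) • (1 : Matrix a a ℂ) := by
  ext i i'
  have h1 : ∀ k, ∑ j, v j (k, i) * star (v j (k, i')) = (1 : Matrix a a ℂ) i i' := by
    intro k
    have := congrFun (congrFun h (k, i)) (k, i')
    rw [Matrix.sum_apply] at this
    refine Eq.trans this ?_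
    by_cases hi : i = i'
    · subst hi
      simp
    · simp [hi]
  simp only [Matrix.sum_apply, Matrix.mul_apply, Matrix.conjTranspose_apply, krausOf,
    Matrix.of_apply, star_star]
  rw [Finset.sum_comm]
  simp only [h1, Finset.sum_const, Finset.card_univ, Matrix.smul_apply, smul_eq_mul,
    nsmul_eq_mul]

end OutputOp

/-! ### Monotonicity of the entanglement of formation -/

section Monotonicity

/-- The entanglement of formation does not increase under local operations and shared
randomness. -/
theorem entanglementOfFormation_le_of_local {a b ι : Type*} [Fintype a] [DecidableEq a] [Fintype b]
    [DecidableEq b] [Fintype ι] {p : ι → ℝ} (hp : ∀ i, 0 ≤ p i) (hp1 : ∑ i, p i = 1)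
    {I J : ι → Type*} [∀ i, Fintype (I i)] [∀ i, Fintype (J i)]
    {K : ∀ i, I i → Matrix a a ℂ} {L : ∀ i, J i → Matrix b b ℂ}
    (hK : ∀ i, ∑ k, (K i k)ᴴ * K i k = 1) (hL : ∀ i, ∑ l, (L i l)ᴴ * L i l = 1)
    {σ τ : Matrix (a × b) (a × b) ℂ} (hσ : IsState σ) (hτ : τ.trace = 1)
    (h : τ = ∑ i, (p i : ℂ) • ∑ k, ∑ l, (K i k ⊗ₖ L i l) * σ * (K i k ⊗ₖ L i l)ᴴ) :
    entanglementOfFormation τ ≤ entanglementOfFormation σ := by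
  refine le_of_forall_pos_le_add fun ε hε => ?_
  obtain ⟨m, φ, hφ, hlt⟩ := exists_decomposition_lt hσ hε
  have hn : ∀ i, Complex.normSq ((Real.sqrt (p i) : ℝ) : ℂ) = p i := fun i => by
    rw [Complex.normSq_ofReal, Real.mul_self_sqrt (hp i)]
  let Φ : (Σ i, I i × J i × Fin m) → a × b → ℂ := fun x =>
    ((Real.sqrt (p x.1) : ℝ) : ℂ) • ((K x.1 x.2.1 ⊗ₖ L x.1 x.2.2.1) *ᵥ φ x.2.2.2)
  have hΦ : τ = ∑ x, ketbra (Φ x) := by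
    rw [h, Fintype.sum_sigma]
    refine Finset.sum_congr rfl fun i _ => ?_
    simp only [Φ, ketbra_smul, hn, ketbra_mulVec, Fintype.sum_prod_type, ← Finset.smul_sum]
    congr 1
    refine Finset.sum_congr rfl fun k _ => Finset.sum_congr rfl fun l _ => ?_
    rw [hφ, Matrix.mul_sum, Matrix.sum_mul]
  refine (entanglementOfFormation_le hτ hΦ).trans (le_trans ?_ hlt.le)
  have hsum : ∀ i, ∑ y : I i × J i × Fin m, entWeight (Φ ⟨i, y⟩) ≤
      p i * ∑ j, entWeight (φ j) := by
    intro i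
    have e : ∑ y : I i × J i × Fin m, entWeight (Φ ⟨i, y⟩) =
        p i * ∑ j, ∑ k, ∑ l, entWeight ((K i k ⊗ₖ L i l) *ᵥ φ j) := by
      simp only [Φ, entWeight_smul, hn, Fintype.sum_prod_type, ← Finset.mul_sum]
      congr 1
      rw [Finset.sum_comm (γ := Fin m)]
      exact Finset.sum_congr rfl fun k _ => Finset.sum_comm
    rw [e]
    exact mul_le_mul_of_nonneg_left
      (Finset.sum_le_sum fun j _ => sum_entWeight_kronecker_le (hK i) (hL i) (φ j)) (hp i)
  rw [Fintype.sum_sigma]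
  refine (Finset.sum_le_sum fun i _ => hsum i).trans (le_of_eq ?_)
  rw [← Finset.sum_mul, hp1, one_mul]

end Monotonicity

/-! ### Teleportation games and the comparison of states -/

section GamesDetectEntanglement

variable {a b : Type u} [Fintype a] [DecidableEq a] [Fintype b] [DecidableEq b]

/-- The vector of a multiple of a maximally entangled state given by the matrix `U`. -/
def bellVector (w : ℝ) (U : Matrix a a ℂ) : a × a → ℂ :=
  (Real.sqrt w : ℂ) • fun v => star (U v.1 v.2)

theorem krausOf_bellVector (w : ℝ) (U : Matrix a a ℂ) :
    krausOf (bellVector w U) = (Real.sqrt w : ℂ) • U := by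
  ext k i
  simp [krausOf, bellVector]

variable {X : Type u} [Fintype X] {U : X → Matrix a a ℂ} {w : ℝ}

theorem isPOVM_bellVector (hw : 0 ≤ w)
    (hU : ∀ k i k' i', ∑ x, (w : ℂ) * (star (U x k i) * U x k' i') =
      if k = k' ∧ i = i' then 1 else 0) :
    IsPOVM fun x => ketbra (bellVector w (U x)) := by
  refine ⟨fun x => posSemidef_ketbra _, ?_⟩
  ext ⟨k, i⟩ ⟨k', i'⟩
  simp only [bellVector, ketbra_smul, Complex.normSq_ofReal, Real.mul_self_sqrt hw,
    Matrix.sum_apply, Matrix.smul_apply]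
  simp only [ketbra, Matrix.vecMulVec_apply, Pi.star_apply, star_star, smul_eq_mul, hU,
    Matrix.one_apply, Prod.mk.injEq]

/-- The design relation is summed down one column, which has unit norm. -/
theorem sum_weight_eq_card [Nonempty a] (hU1 : ∀ x, (U x)ᴴ * U x = 1)
    (hU : ∀ k i k' i', ∑ x, (w : ℂ) * (star (U x k i) * U x k' i') =
      if k = k' ∧ i = i' then 1 else 0) :
    ∑ _x : X, (w : ℂ) = Fintype.card a := by
  obtain ⟨i⟩ := ‹Nonempty a›
  have h1 : ∀ x, ∑ k, star (U x k i) * U x k i = 1 := fun x => by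
    have := congrFun (congrFun (hU1 x) i) i
    rwa [Matrix.one_apply_eq] at this
  calc ∑ _x : X, (w : ℂ) = ∑ x, (w : ℂ) * ∑ k, star (U x k i) * U x k i := by
        simp only [h1, mul_one]
    _ = ∑ k, ∑ x, (w : ℂ) * (star (U x k i) * U x k i) := by
        simp only [Finset.mul_sum]
        exact Finset.sum_comm
    _ = Fintype.card a := by
        simp only [hU, and_self, if_true, Finset.sum_const, Finset.card_univ, nsmul_eq_mul, mul_one]

/-- The Kraus operators of the local channel obtained from a measurement on `ℂ^a ⊗ ℂ^a` followed by
a unitary correction depending on the outcome. -/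
def correctedKraus (U : X → Matrix a a ℂ) {m : X → ℕ} (v : ∀ x, Fin (m x) → a × a → ℂ)
    (k : Σ x, Fin (m x)) : Matrix a a ℂ :=
  (((Real.sqrt (Fintype.card a))⁻¹ : ℝ) : ℂ) • ((U k.1)ᴴ * krausOf (v k.1 k.2))

theorem inv_sqrt_card_mul_self [Nonempty a] :
    (((Real.sqrt (Fintype.card a))⁻¹ : ℝ) : ℂ) * (((Real.sqrt (Fintype.card a))⁻¹ : ℝ) : ℂ) =
      (Fintype.card a : ℂ)⁻¹ := by
  rw [← Complex.ofReal_mul, ← mul_inv, Real.mul_self_sqrt (Nat.cast_nonneg _)]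
  simp

/-- The corrections are unitary and drop out, leaving the completeness of the measurement. -/
theorem sum_correctedKraus [Nonempty a] (hU1 : ∀ x, (U x)ᴴ * U x = 1) {m : X → ℕ}
    {v : ∀ x, Fin (m x) → a × a → ℂ} {P : X → Matrix (a × a) (a × a) ℂ} (hP : IsPOVM P)
    (hv : ∀ x, P x = ∑ r, ketbra (v x r)) :
    ∑ k, (correctedKraus U v k)ᴴ * correctedKraus U v k = 1 := by
  have hone : ∑ k : (Σ x, Fin (m x)), ketbra (v k.1 k.2) = 1 := by
    rw [Fintype.sum_sigma, ← hP.2]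
    exact Finset.sum_congr rfl fun x _ => (hv x).symm
  have hterm : ∀ k : (Σ x, Fin (m x)), (correctedKraus U v k)ᴴ * correctedKraus U v k =
      (Fintype.card a : ℂ)⁻¹ • ((krausOf (v k.1 k.2))ᴴ * krausOf (v k.1 k.2)) := by
    intro k
    have hUU : U k.1 * (U k.1)ᴴ = 1 := mul_eq_one_comm.1 (hU1 k.1)
    rw [correctedKraus, Matrix.conjTranspose_smul, Matrix.smul_mul, Matrix.mul_smul, smul_smul,
      RCLike.star_def, Complex.conj_ofReal, inv_sqrt_card_mul_self, Matrix.conjTranspose_mul,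
      Matrix.conjTranspose_conjTranspose, Matrix.mul_assoc, ← Matrix.mul_assoc (U k.1), hUU,
      Matrix.one_mul]
  simp only [hterm, ← Finset.smul_sum]
  rw [sum_krausOf (v := fun k : (Σ x, Fin (m x)) => v k.1 k.2) hone, smul_smul, inv_mul_cancel₀,
    one_smul]
  exact Nat.cast_ne_zero.2 Fintype.card_ne_zero

/-- Expresses the corrected channel through the operators `outputOp (P x) (Q y) σ`, which are what
the correlations control. -/
theorem sum_correctedKraus_conj [Nonempty a] [Nonempty b] {Y : Type u} [Fintype Y]
    {V : Y → Matrix b b ℂ} {m : X → ℕ} {v : ∀ x, Fin (m x) → a × a → ℂ}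
    {P : X → Matrix (a × a) (a × a) ℂ} (hv : ∀ x, P x = ∑ r, ketbra (v x r)) {m' : Y → ℕ}
    {v' : ∀ y, Fin (m' y) → b × b → ℂ} {Q : Y → Matrix (b × b) (b × b) ℂ}
    (hv' : ∀ y, Q y = ∑ r, ketbra (v' y r)) (σ : Matrix (a × b) (a × b) ℂ) :
    ∑ k, ∑ l, (correctedKraus U v k ⊗ₖ correctedKraus V v' l) * σ *
        (correctedKraus U v k ⊗ₖ correctedKraus V v' l)ᴴ =
      ((Fintype.card a : ℂ)⁻¹ * (Fintype.card b : ℂ)⁻¹) • ∑ x, ∑ y,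
        (U x ⊗ₖ V y)ᴴ * outputOp (P x) (Q y) σ * (U x ⊗ₖ V y) := by
  have hterm : ∀ k l, (correctedKraus U v k ⊗ₖ correctedKraus V v' l) * σ *
        (correctedKraus U v k ⊗ₖ correctedKraus V v' l)ᴴ =
      ((Fintype.card a : ℂ)⁻¹ * (Fintype.card b : ℂ)⁻¹) • ((U k.1 ⊗ₖ V l.1)ᴴ *
        outputOp (ketbra (v k.1 k.2)) (ketbra (v' l.1 l.2)) σ * (U k.1 ⊗ₖ V l.1)) := by
    intro k l
    have hkr : correctedKraus U v k ⊗ₖ correctedKraus V v' l =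
        ((((Real.sqrt (Fintype.card a))⁻¹ : ℝ) : ℂ) * (((Real.sqrt (Fintype.card b))⁻¹ : ℝ) : ℂ)) •
          ((U k.1 ⊗ₖ V l.1)ᴴ * (krausOf (v k.1 k.2) ⊗ₖ krausOf (v' l.1 l.2))) := by
      rw [correctedKraus, correctedKraus, Matrix.smul_kronecker, Matrix.kronecker_smul, smul_smul,
        Matrix.mul_kronecker_mul, Matrix.conjTranspose_kronecker]
    rw [hkr, outputOp_ketbra, Matrix.conjTranspose_smul, Matrix.smul_mul, Matrix.smul_mul,
      Matrix.mul_smul, smul_smul, Matrix.conjTranspose_mul, Matrix.conjTranspose_conjTranspose,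
      ← inv_sqrt_card_mul_self (a := a), ← inv_sqrt_card_mul_self (a := b)]
    congr 1
    · simp only [RCLike.star_def, map_mul, Complex.conj_ofReal]
      ring
    · simp only [Matrix.mul_assoc]
  simp only [hterm, ← Finset.smul_sum]
  congr 1
  rw [Fintype.sum_sigma]
  refine Finset.sum_congr rfl fun x _ => ?_
  simp only [Fintype.sum_sigma]
  rw [Finset.sum_comm]
  refine Finset.sum_congr rfl fun y _ => ?_
  rw [hv, hv', outputOp_sum, Matrix.mul_sum, Matrix.sum_mul]
  refine Finset.sum_congr rfl fun r _ => ?_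
  rw [Matrix.mul_sum, Matrix.sum_mul]

/-- Semiquantum nonlocal games detect the entanglement of formation: a state that performs at least
as well in all games is at least as entangled. -/
theorem entanglementOfFormation_le_of_payoff_le {σ τ : Matrix (a × b) (a × b) ℂ} (hσ : IsState σ)
    (hτ : IsState τ)
    (h : ∀ (S T X Y A₀ B₀ : Type u) [Fintype S] [Fintype T] [Fintype X] [Fintype Y]
      [Nonempty X] [Nonempty Y] [Fintype A₀] [DecidableEq A₀] [Fintype B₀] [DecidableEq B₀]
      (G : Game S T X Y A₀ B₀), payoff G τ ≤ payoff G σ) :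
    entanglementOfFormation τ ≤ entanglementOfFormation σ := by
  have hne : Nonempty (a × b) := by
    by_contra hc
    rw [not_nonempty_iff] at hc
    have := hσ.2
    simp [Matrix.trace] at this
  have hna : Nonempty a := hne.map Prod.fst
  have hnb : Nonempty b := hne.map Prod.snd
  obtain ⟨S, _, _, ζ, hζ, hζC⟩ := exists_informationallyComplete a
  obtain ⟨T, _, _, η, hη, hηC⟩ := exists_informationallyComplete b
  obtain ⟨X, _, _, U, w, hw, hU1, hU⟩ := exists_unitaryDesign a
  obtain ⟨Y, _, _, V, w', hw', hV1, hV⟩ := exists_unitaryDesign b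
  -- The correlation to be simulated is that of the rotated Bell measurements on τ.
  have hmem := correlation_mem_convexHull hζ hη (fun G => h S T X Y a b G)
    (isPOVM_bellVector hw hU) (isPOVM_bellVector hw' hV)
  obtain ⟨ι, _, p, z, hp, hp1, hz, hsum⟩ := mem_convexHull_iff_exists_fintype.1 hmem
  choose PQ hPQ hcorr using hz
  -- Equal correlations on informationally complete questions give equal operators, for each pair of
  -- outcomes.
  have key : ∀ x y, ∑ i, (p i : ℂ) • outputOp ((PQ i).1 x) ((PQ i).2 y) σ =
      ((w : ℂ) * w') • ((U x ⊗ₖ V y) * τ * (U x ⊗ₖ V y)ᴴ) := by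
    intro x y
    have hbell : outputOp (ketbra (bellVector w (U x))) (ketbra (bellVector w' (V y))) τ =
        ((w : ℂ) * w') • ((U x ⊗ₖ V y) * τ * (U x ⊗ₖ V y)ᴴ) := by
      rw [outputOp_ketbra, krausOf_bellVector, krausOf_bellVector, Matrix.smul_kronecker,
        Matrix.kronecker_smul, smul_smul, Matrix.conjTranspose_smul, Matrix.smul_mul,
        Matrix.smul_mul, Matrix.mul_smul, smul_smul]
      congr 1
      simp only [RCLike.star_def, map_mul, Complex.conj_ofReal]
      rw [mul_mul_mul_comm, ← Complex.ofReal_mul, ← Complex.ofReal_mul, Real.mul_self_sqrt hw,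
        Real.mul_self_sqrt hw']
    rw [← hbell]
    refine eq_of_questionValue_re_eq hζ hη hζC hηC ?_ ?_ fun s t => ?_
    · rw [Matrix.IsHermitian, Matrix.conjTranspose_sum]
      refine Finset.sum_congr rfl fun i _ => ?_
      rw [Matrix.conjTranspose_smul, RCLike.star_def, Complex.conj_ofReal,
        (isHermitian_outputOp ((hPQ i).1.1 x).isHermitian ((hPQ i).2.1 y).isHermitian
          hσ.1.isHermitian).eq]
    · exact isHermitian_outputOp (posSemidef_ketbra _).isHermitian
        (posSemidef_ketbra _).isHermitian hτ.1.isHermitian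
    · have hst := congrFun hsum (s, t, x, y)
      rw [Finset.sum_apply] at hst
      rw [questionValue_sum_smul, Complex.re_sum, ← trace_eq_questionValue]
      refine Eq.trans (Finset.sum_congr rfl fun i _ => ?_) hst
      rw [Complex.re_ofReal_mul, ← trace_eq_questionValue, Pi.smul_apply, smul_eq_mul,
        ← hcorr i]
      rfl
  have hdecA : ∀ i x, ∃ (m : ℕ) (v : Fin m → a × a → ℂ), (PQ i).1 x = ∑ r, ketbra (v r) :=
    fun i x => Matrix.posSemidef_iff_eq_sum_vecMulVec.1 ((hPQ i).1.1 x)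
  have hdecB : ∀ i y, ∃ (m : ℕ) (v : Fin m → b × b → ℂ), (PQ i).2 y = ∑ r, ketbra (v r) :=
    fun i y => Matrix.posSemidef_iff_eq_sum_vecMulVec.1 ((hPQ i).2.1 y)
  choose mA vA hvA using hdecA
  choose mB vB hvB using hdecB
  refine entanglementOfFormation_le_of_local hp hp1
    (K := fun i => correctedKraus U (vA i)) (L := fun i => correctedKraus V (vB i))
    (fun i => sum_correctedKraus hU1 (hPQ i).1 (hvA i))
    (fun i => sum_correctedKraus hV1 (hPQ i).2 (hvB i)) hσ hτ.2 ?_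
  simp only [sum_correctedKraus_conj (hvA _) (hvB _)]
  have hinv : ∀ x y, (U x ⊗ₖ V y)ᴴ * (U x ⊗ₖ V y) = 1 := by
    intro x y
    rw [Matrix.conjTranspose_kronecker, ← Matrix.mul_kronecker_mul, hU1, hV1,
      Matrix.one_kronecker_one]
  have hxy : ∀ x y, ∑ i, (p i : ℂ) • ((U x ⊗ₖ V y)ᴴ *
      outputOp ((PQ i).1 x) ((PQ i).2 y) σ * (U x ⊗ₖ V y)) = ((w : ℂ) * w') • τ := by
    intro x y
    calc _ = (U x ⊗ₖ V y)ᴴ * (∑ i, (p i : ℂ) • outputOp ((PQ i).1 x) ((PQ i).2 y) σ) *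
          (U x ⊗ₖ V y) := by
          simp only [Matrix.mul_sum, Matrix.sum_mul, Matrix.mul_smul, Matrix.smul_mul]
      _ = ((w : ℂ) * w') • (((U x ⊗ₖ V y)ᴴ * (U x ⊗ₖ V y)) * τ *
            ((U x ⊗ₖ V y)ᴴ * (U x ⊗ₖ V y))) := by
          rw [key]
          simp only [Matrix.mul_smul, Matrix.smul_mul, Matrix.mul_assoc]
      _ = ((w : ℂ) * w') • τ := by rw [hinv, Matrix.one_mul, Matrix.mul_one]
  have hA : (Fintype.card a : ℂ) ≠ 0 := Nat.cast_ne_zero.2 Fintype.card_ne_zero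
  have hB : (Fintype.card b : ℂ) ≠ 0 := Nat.cast_ne_zero.2 Fintype.card_ne_zero
  symm
  -- After correction every outcome pair contributes w * w' times τ; the total weights card a and
  -- card b cancel the normalization.
  calc ∑ i, (p i : ℂ) • ((Fintype.card a : ℂ)⁻¹ * (Fintype.card b : ℂ)⁻¹) • ∑ x, ∑ y,
        (U x ⊗ₖ V y)ᴴ * outputOp ((PQ i).1 x) ((PQ i).2 y) σ * (U x ⊗ₖ V y)
      = ((Fintype.card a : ℂ)⁻¹ * (Fintype.card b : ℂ)⁻¹) • ∑ x, ∑ y, ∑ i, (p i : ℂ) •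
        ((U x ⊗ₖ V y)ᴴ * outputOp ((PQ i).1 x) ((PQ i).2 y) σ * (U x ⊗ₖ V y)) := by
        simp only [smul_comm (p _ : ℂ), ← Finset.smul_sum]
        congr 1
        simp only [Finset.smul_sum]
        rw [Finset.sum_comm]
        exact Finset.sum_congr rfl fun x _ => Finset.sum_comm
    _ = ((Fintype.card a : ℂ)⁻¹ * (Fintype.card b : ℂ)⁻¹) •
        ((∑ _x : X, (w : ℂ)) * ∑ _y : Y, (w' : ℂ)) • τ := by
        simp only [hxy, Finset.sum_mul_sum, Finset.sum_smul]
    _ = τ := by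
        rw [sum_weight_eq_card hU1 hU, sum_weight_eq_card hV1 hV, smul_smul]
        field_simp
        rw [one_smul]

/-- The effective entanglement of formation under a restriction to locally pinched measurements is
the entanglement of formation of the pinched state. -/
theorem effectiveEntanglement_eq {κ C C' : Type*} [DecidableEq C] [DecidableEq C'] {k : Finset κ}
    {K : κ → Matrix (a × b) (a × b) ℂ} {fA : a → C} {fB : b → C'}
    (hK : ∀ M, krausDual k K M = pinch (fun v : a × b => (fA v.1, fB v.2)) M)
    {ρ : Matrix (a × b) (a × b) ℂ} (hρ : IsState ρ) :
    effectiveEntanglement k K entanglementOfFormation ρ =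
      entanglementOfFormation (pinch (fun v : a × b => (fA v.1, fB v.2)) ρ) := by
  refine le_antisymm ?_ ?_
  -- The pinched state is itself admissible.
  · refine csInf_le ⟨0, ?_⟩ ⟨_, isState_pinch _ hρ, ?_, rfl⟩
    · rintro e ⟨σ, -, -, rfl⟩
      exact entanglementOfFormation_nonneg σ
    · intro S T X Y A₀ B₀ _ _ _ _ _ _ _ _ _ _ G
      exact (restrictedPayoff_eq_payoff_pinch hK G ρ).le
  · refine le_csInf ⟨_, _, isState_pinch (fun v : a × b => (fA v.1, fB v.2)) hρ, ?_, rfl⟩ ?_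
    · intro S T X Y A₀ B₀ _ _ _ _ _ _ _ _ _ _ G
      exact (restrictedPayoff_eq_payoff_pinch hK G ρ).le
    · rintro e ⟨σ, hσ, hout, rfl⟩
      refine entanglementOfFormation_le_of_payoff_le hσ (isState_pinch _ hρ) ?_
      intro S T X Y A₀ B₀ _ _ _ _ _ _ _ _ _ _ G
      rw [← restrictedPayoff_eq_payoff_pinch hK G ρ]
      exact hout S T X Y A₀ B₀ G

end GamesDetectEntanglement

/-! ### The particle-number super-selection rule -/

section SSR

variable {a b : Type*} [Fintype a] [DecidableEq a] [Fintype b] [DecidableEq b]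
  (nA : a → ℕ) (nB : b → ℕ)

theorem aliceProj_eq : aliceProj b nA = blockProj fun v : a × b => nA v.1 := by
  funext n
  rw [aliceProj, numberProj, ← Matrix.diagonal_one, Matrix.diagonal_kronecker_diagonal]
  simp [blockProj]

theorem bobProj_eq : bobProj a nB = blockProj fun v : a × b => nB v.2 := by
  funext n
  rw [bobProj, numberProj, ← Matrix.diagonal_one, Matrix.diagonal_kronecker_diagonal]
  simp [blockProj]

theorem bothProj_eq : bothProj nA nB = blockProj fun v : a × b => (nA v.1, nB v.2) := by
  funext n
  rw [bothProj, numberProj, numberProj, Matrix.diagonal_kronecker_diagonal, blockProj]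
  congr 1
  ext v
  by_cases h1 : nA v.1 = n.1 <;> by_cases h2 : nB v.2 = n.2 <;> simp [h1, h2, Prod.ext_iff]

theorem mem_sectors (i : a) : nA i ∈ sectors nA := by simp [sectors]

theorem ssrState_eq_pinch (ρ : Matrix (a × b) (a × b) ℂ) :
    ssrState nA ρ = pinch (fun v => nA v.1) ρ := by
  rw [ssrState, aliceProj_eq, krausMap_blockProj (fun v : a × b => nA v.1) fun v => mem_sectors nA v.1]

variable {nA nB}

theorem HasTotalNumber.apply_eq_zero {N : ℕ} {ρ : Matrix (a × b) (a × b) ℂ}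
    (hN : HasTotalNumber nA nB N ρ) {v w : a × b}
    (h : ¬ (nA v.1 + nB v.2 = N ∧ nA w.1 + nB w.2 = N)) : ρ v w = 0 := by
  have h1 := congrFun (congrFun hN v) w
  rw [← h1]
  exact (blockProj_mul_mul_apply (fun v : a × b => nA v.1 + nB v.2) N ρ v w).trans (if_neg h)

/-- Entries of ρ vanish unless both indices have total number N, so labels need only agree with
Alice's number among indices of equal total. -/
theorem HasTotalNumber.pinch_eq {N : ℕ} {ρ : Matrix (a × b) (a × b) ℂ}
    (hN : HasTotalNumber nA nB N ρ) {C : Type*} [DecidableEq C] {f : a × b → C}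
    (hf : ∀ v w, nA v.1 + nB v.2 = nA w.1 + nB w.2 → (f v = f w ↔ nA v.1 = nA w.1)) :
    pinch f ρ = pinch (fun v => nA v.1) ρ := by
  ext v w
  rw [pinch_apply, pinch_apply]
  by_cases h : nA v.1 + nB v.2 = N ∧ nA w.1 + nB w.2 = N
  · simp only [hf v w (h.1.trans h.2.symm)]
  · simp [hN.apply_eq_zero h]

variable (nA)

theorem blockProj_mul_self {H C : Type*} [Fintype H] [DecidableEq H] [DecidableEq C] (f : H → C)
    (c : C) : blockProj f c * blockProj f c = blockProj f c := by
  rw [blockProj, Matrix.diagonal_mul_diagonal]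
  congr 1
  ext i
  by_cases h : f i = c <;> simp [h]

theorem conjTranspose_aliceProj (n : ℕ) : (aliceProj b nA n)ᴴ = aliceProj b nA n := by
  rw [aliceProj_eq, conjTranspose_blockProj]

theorem posSemidef_sector {ρ : Matrix (a × b) (a × b) ℂ} (hρ : ρ.PosSemidef) (n : ℕ) :
    (aliceProj b nA n * ρ * aliceProj b nA n).PosSemidef := by
  have := hρ.conjTranspose_mul_mul_same (aliceProj b nA n)
  rwa [conjTranspose_aliceProj] at this

theorem trace_sector {ρ : Matrix (a × b) (a × b) ℂ} (hρ : ρ.PosSemidef) (n : ℕ) :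
    (aliceProj b nA n * ρ * aliceProj b nA n).trace = (sectorProb nA ρ n : ℂ) := by
  have h0 := Complex.le_def.1 (posSemidef_sector nA hρ n).trace_nonneg
  have h1 : (aliceProj b nA n * ρ * aliceProj b nA n).trace = (aliceProj b nA n * ρ).trace := by
    rw [Matrix.trace_mul_cycle, aliceProj_eq, blockProj_mul_self]
  rw [h1] at h0 ⊢
  exact Complex.ext rfl h0.2.symm

theorem sectorProb_nonneg {ρ : Matrix (a × b) (a × b) ℂ} (hρ : ρ.PosSemidef) (n : ℕ) :
    0 ≤ sectorProb nA ρ n := by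
  have h0 := (posSemidef_sector nA hρ n).trace_nonneg
  rw [trace_sector nA hρ n] at h0
  exact Complex.zero_le_real.1 h0

/-- If p_n = 0, the positive block has trace zero and vanishes, so the junk value of the inverse is
harmless. -/
theorem sectorProb_smul_sectorState {ρ : Matrix (a × b) (a × b) ℂ} (hρ : ρ.PosSemidef) (n : ℕ) :
    (sectorProb nA ρ n : ℂ) • sectorState nA ρ n =
      aliceProj b nA n * ρ * aliceProj b nA n := by
  by_cases h : sectorProb nA ρ n = 0
  · have h0 := trace_sector nA hρ n
    rw [h, Complex.ofReal_zero, (posSemidef_sector nA hρ n).trace_eq_zero_iff] at h0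
    rw [h0, h, Complex.ofReal_zero, zero_smul]
  · rw [sectorState, smul_smul, mul_inv_cancel₀ (Complex.ofReal_ne_zero.2 h), one_smul]

theorem isState_sectorState {ρ : Matrix (a × b) (a × b) ℂ} (hρ : ρ.PosSemidef) {n : ℕ}
    (h : sectorProb nA ρ n ≠ 0) : IsState (sectorState nA ρ n) := by
  refine ⟨(posSemidef_sector nA hρ n).smul ?_, ?_⟩
  · rw [← Complex.ofReal_inv]
    exact Complex.zero_le_real.2 (inv_nonneg.2 (sectorProb_nonneg nA hρ n))
  · rw [sectorState, Matrix.trace_smul, trace_sector nA hρ n, smul_eq_mul,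
      inv_mul_cancel₀ (Complex.ofReal_ne_zero.2 h)]

theorem ssrState_eq_sum {ρ : Matrix (a × b) (a × b) ℂ} (hρ : ρ.PosSemidef) :
    ssrState nA ρ = ∑ n ∈ sectors nA, (sectorProb nA ρ n : ℂ) • sectorState nA ρ n := by
  simp only [ssrState, krausMap, sectorProb_smul_sectorState nA hρ, conjTranspose_aliceProj]

theorem sum_sectorProb {ρ : Matrix (a × b) (a × b) ℂ} (hρ : IsState ρ) :
    ∑ n ∈ sectors nA, sectorProb nA ρ n = 1 := by
  have h : (ssrState nA ρ).trace = 1 := by rw [ssrState_eq_pinch, trace_pinch, hρ.2]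
  simp only [ssrState, krausMap, conjTranspose_aliceProj, Matrix.trace_sum,
    trace_sector nA hρ.1] at h
  exact_mod_cast h

theorem isState_ssrState {ρ : Matrix (a × b) (a × b) ℂ} (hρ : IsState ρ) :
    IsState (ssrState nA ρ) := by
  rw [ssrState_eq_pinch]
  exact isState_pinch _ hρ

theorem aliceProj_conj_ssrState (ρ : Matrix (a × b) (a × b) ℂ) (n : ℕ) :
    aliceProj b nA n * ssrState nA ρ * aliceProj b nA n =
      aliceProj b nA n * ρ * aliceProj b nA n := by
  rw [ssrState_eq_pinch, aliceProj_eq]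
  ext v w
  rw [blockProj_mul_mul_apply, blockProj_mul_mul_apply, pinch_apply]
  split_ifs with h1 h2
  · rfl
  · exact absurd (h1.1.trans h1.2.symm) h2
  · rfl

/-! ### Pure states -/

theorem sector_ketbra (ψ : a × b → ℂ) (n : ℕ) :
    aliceProj b nA n * ketbra ψ * aliceProj b nA n = ketbra (aliceProj b nA n *ᵥ ψ) := by
  rw [ketbra_mulVec, conjTranspose_aliceProj]

theorem sectorProb_ketbra (ψ : a × b → ℂ) (n : ℕ) :
    sectorProb nA (ketbra ψ) n = normSq (aliceProj b nA n *ᵥ ψ) := by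
  have h := trace_sector nA (posSemidef_ketbra ψ) n
  rw [sector_ketbra, trace_ketbra] at h
  exact_mod_cast h.symm

/-- Each block of a pure state is again rank one, so its entanglement of formation is known. -/
theorem sectorProb_mul_entanglementOfFormation (ψ : a × b → ℂ) (n : ℕ) :
    sectorProb nA (ketbra ψ) n * entanglementOfFormation (sectorState nA (ketbra ψ) n) =
      entWeight (aliceProj b nA n *ᵥ ψ) := by
  rw [entWeight, sectorState, sector_ketbra, sectorProb_ketbra]
  by_cases h : normSq (aliceProj b nA n *ᵥ ψ) = 0
  · rw [h, zero_mul, zero_mul]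
  · rw [← entWeight_of_normSq_eq_one (normSq_normalize h),
      ← entanglementOfFormation_ketbra (normSq_normalize h), ketbra_smul, map_inv₀,
      Complex.normSq_ofReal, Real.mul_self_sqrt (normSq_nonneg _), Complex.ofReal_inv]

theorem sum_numberProj_conjTranspose_mul_self :
    ∑ n : sectors nA, (numberProj nA n)ᴴ * numberProj nA n = 1 := by
  rw [Finset.sum_coe_sort (sectors nA) fun n => (numberProj nA n)ᴴ * numberProj nA n]
  have h := krausDual_blockProj nA (mem_sectors nA) (1 : Matrix a a ℂ)
  rw [pinch_one] at h
  simp only [krausDual, Matrix.mul_one] at h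
  exact h

/-- Projecting a decomposition of ρ̄ to sector n decomposes the pure block of ψ, whose cost is
independent of the decomposition. Summing over n is a local measurement, which does not raise the
average cost. -/
theorem sum_entWeight_le_entanglementOfFormation_ssrState {ψ : a × b → ℂ}
    (hψ : IsState (ketbra ψ)) :
    ∑ n ∈ sectors nA, entWeight (aliceProj b nA n *ᵥ ψ) ≤
      entanglementOfFormation (ssrState nA (ketbra ψ)) := by
  refine le_entanglementOfFormation (isState_ssrState nA hψ) fun k φ hφ => ?_
  have hsec : ∀ n, ∑ i, entWeight (aliceProj b nA n *ᵥ φ i) =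
      entWeight (aliceProj b nA n *ᵥ ψ) := by
    intro n
    refine sum_entWeight_eq_of_ketbra_eq ?_
    rw [← sector_ketbra, ← aliceProj_conj_ssrState, hφ, Matrix.mul_sum, Matrix.sum_mul]
    simp only [sector_ketbra]
  simp only [← hsec]
  rw [Finset.sum_comm]
  refine Finset.sum_le_sum fun i _ => ?_
  rw [← Finset.sum_coe_sort (sectors nA)]
  exact sum_entWeight_left_le (sum_numberProj_conjTranspose_mul_self nA) (φ i)

theorem blockProj_mulVec_apply {H C : Type*} [Fintype H] [DecidableEq H] [DecidableEq C]
    (f : H → C) (c : C) (ψ : H → ℂ) (i : H) :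
    (blockProj f c *ᵥ ψ) i = if f i = c then ψ i else 0 := by
  rw [blockProj, Matrix.mulVec_diagonal]
  by_cases h : f i = c <;> simp [h]

theorem entanglementOfParticles_eq {N : ℕ} {ψ : a × b → ℂ}
    (hN : HasTotalNumber nA nB N (ketbra ψ)) :
    entanglementOfParticles nA nB N ψ =
      ∑ n ∈ sectors nA, entWeight (aliceProj b nA n *ᵥ ψ) := by
  -- The diagonal entry of `ketbra ψ` at v is |ψ v|².
  have hψ : ∀ v : a × b, nA v.1 + nB v.2 ≠ N → ψ v = 0 := by
    intro v hv
    have h := hN.apply_eq_zero (v := v) (w := v) fun h => hv h.1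
    rw [ketbra, Matrix.vecMulVec_apply, Pi.star_apply] at h
    rcases mul_eq_zero.1 h with h | h
    · exact h
    · exact star_eq_zero.1 h
  have hboth : ∀ nm ∈ Finset.HasAntidiagonal.antidiagonal N,
      bothProj nA nB nm *ᵥ ψ = aliceProj b nA nm.1 *ᵥ ψ := by
    intro nm hnm
    rw [Finset.HasAntidiagonal.mem_antidiagonal] at hnm
    funext v
    rw [bothProj_eq, aliceProj_eq, blockProj_mulVec_apply, blockProj_mulVec_apply]
    by_cases hv : nA v.1 + nB v.2 = N
    · have : (nA v.1, nB v.2) = nm ↔ nA v.1 = nm.1 := by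
        rw [Prod.ext_iff]
        constructor
        · exact fun h => h.1
        · intro h
          exact ⟨h, by dsimp only; omega⟩
      simp only [this]
    · simp [hψ v hv]
  have hzero : ∀ n, (n ∉ sectors nA ∨ n ∉ Finset.range (N + 1)) →
      entWeight (aliceProj b nA n *ᵥ ψ) = 0 := by
    intro n hn
    have : aliceProj b nA n *ᵥ ψ = 0 := by
      funext v
      rw [aliceProj_eq, blockProj_mulVec_apply, Pi.zero_apply]
      split_ifs with h
      · rcases hn with hn | hn
        · exact absurd (h ▸ mem_sectors nA v.1) hn
        · refine hψ v fun hv => hn (Finset.mem_range.2 ?_)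
          omega
      · rfl
    rw [this, entWeight_zero]
  have h1 : entanglementOfParticles nA nB N ψ =
      ∑ nm ∈ Finset.HasAntidiagonal.antidiagonal N, entWeight (aliceProj b nA nm.1 *ᵥ ψ) :=
    Finset.sum_congr rfl fun nm hnm => by
      rw [← hboth nm hnm]
      rfl
  rw [h1, Finset.Nat.sum_antidiagonal_eq_sum_range_succ_mk]
  dsimp only
  -- One sum runs over 0, …, N and the other over occurring numbers; both extend by zero terms to
  -- the union.
  rw [Finset.sum_subset (Finset.subset_union_left (s₂ := sectors nA)) fun n _ hn =>
      hzero n (Or.inr hn),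
    Finset.sum_subset (Finset.subset_union_right (s₁ := Finset.range N.succ)) fun n _ hn =>
      hzero n (Or.inl hn)]

end SSR

end EffEnt

end

theorem mainTheorem4 {a b : Type u} [Fintype a] [DecidableEq a] [Fintype b] [DecidableEq b]
    (nA : a → ℕ) (nB : b → ℕ) (N : ℕ)
    (ρ : Matrix (a × b) (a × b) ℂ) (hρ : IsState ρ) (hN : HasTotalNumber nA nB N ρ) :
    -- the effective state does not depend on which party is restricted, and is block diagonal
    (IsState (ssrState nA ρ) ∧
      krausMap (sectors nB) (bobProj a nB) ρ = ssrState nA ρ ∧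
      krausMap (sectors nA ×ˢ sectors nB) (bothProj nA nB) ρ = ssrState nA ρ ∧
      ssrState nA ρ = ∑ n ∈ sectors nA, (sectorProb nA ρ n : ℂ) • sectorState nA ρ n) ∧
    -- the effective entanglement of formation is that of the effective state
    (effectiveEntanglement (sectors nA) (aliceProj b nA) entanglementOfFormation ρ =
        entanglementOfFormation (ssrState nA ρ) ∧
      effectiveEntanglement (sectors nB) (bobProj a nB) entanglementOfFormation ρ =
        entanglementOfFormation (ssrState nA ρ) ∧
      effectiveEntanglement (sectors nA ×ˢ sectors nB) (bothProj nA nB)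
          entanglementOfFormation ρ =
        entanglementOfFormation (ssrState nA ρ)) ∧
    -- the upper bound for general states
    entanglementOfFormation (ssrState nA ρ) ≤
      ∑ n ∈ sectors nA, sectorProb nA ρ n * entanglementOfFormation (sectorState nA ρ n) ∧
    -- equality for pure states, and agreement with the entanglement of particles
    (∀ ψ : a × b → ℂ, ρ = ketbra ψ →
      entanglementOfFormation (ssrState nA ρ) =
        ∑ n ∈ sectors nA, sectorProb nA ρ n * entanglementOfFormation (sectorState nA ρ n) ∧
      entanglementOfFormation (ssrState nA ρ) = entanglementOfParticles nA nB N ψ) := by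
  -- The trivial label `()` for the unrestricted party gives all three restrictions the same product
  -- form.
  have hAdual : ∀ M, krausDual (sectors nA) (aliceProj b nA) M =
      pinch (fun v : a × b => (nA v.1, ())) M := fun M => by
    rw [aliceProj_eq, krausDual_blockProj (fun v : a × b => nA v.1) fun v => mem_sectors nA v.1]
    ext v w
    simp [pinch_apply]
  have hBdual : ∀ M, krausDual (sectors nB) (bobProj a nB) M =
      pinch (fun v : a × b => ((), nB v.2)) M := fun M => by
    rw [bobProj_eq, krausDual_blockProj (fun v : a × b => nB v.2) fun v => mem_sectors nB v.2]
    ext v w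
    simp [pinch_apply]
  have hmem : ∀ v : a × b, (nA v.1, nB v.2) ∈ sectors nA ×ˢ sectors nB := fun v =>
    Finset.mem_product.2 ⟨mem_sectors nA v.1, mem_sectors nB v.2⟩
  have hABdual : ∀ M, krausDual (sectors nA ×ˢ sectors nB) (bothProj nA nB) M =
      pinch (fun v : a × b => (nA v.1, nB v.2)) M := fun M => by
    rw [bothProj_eq, krausDual_blockProj _ hmem]
  have hle : entanglementOfFormation (ssrState nA ρ) ≤
      ∑ n ∈ sectors nA, sectorProb nA ρ n * entanglementOfFormation (sectorState nA ρ n) :=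
    entanglementOfFormation_sum_le (isState_ssrState nA hρ).2
      (fun n _ => sectorProb_nonneg nA hρ.1 n) (sum_sectorProb nA hρ)
      (fun n _ h => isState_sectorState nA hρ.1 h) (ssrState_eq_sum nA hρ.1)
  refine ⟨⟨isState_ssrState nA hρ, ?_, ?_, ssrState_eq_sum nA hρ.1⟩, ⟨?_, ?_, ?_⟩, hle, ?_⟩
  · rw [bobProj_eq, krausMap_blockProj (fun v : a × b => nB v.2) fun v => mem_sectors nB v.2, ssrState_eq_pinch]
    exact hN.pinch_eq fun v w h => by omega
  · rw [bothProj_eq, krausMap_blockProj _ hmem, ssrState_eq_pinch]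
    exact hN.pinch_eq fun v w h => by rw [Prod.mk.injEq]; omega
  · rw [effectiveEntanglement_eq (fA := nA) (fB := fun _ => ()) hAdual hρ, ssrState_eq_pinch]
    congr 1
    exact hN.pinch_eq fun v w _ => by simp
  · rw [effectiveEntanglement_eq (fA := fun _ => ()) (fB := nB) hBdual hρ, ssrState_eq_pinch]
    congr 1
    exact hN.pinch_eq fun v w h => by rw [Prod.mk.injEq]; simp; omega
  · rw [effectiveEntanglement_eq hABdual hρ, ssrState_eq_pinch]
    congr 1
    exact hN.pinch_eq fun v w h => by rw [Prod.mk.injEq]; omega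
  · rintro ψ rfl
    have hsum : ∑ n ∈ sectors nA, sectorProb nA (ketbra ψ) n *
        entanglementOfFormation (sectorState nA (ketbra ψ) n) =
        ∑ n ∈ sectors nA, entWeight (aliceProj b nA n *ᵥ ψ) :=
      Finset.sum_congr rfl fun n _ => sectorProb_mul_entanglementOfFormation nA ψ n
    have heq := le_antisymm hle
      (hsum.trans_le (sum_entWeight_le_entanglementOfFormation_ssrState nA hρ))
    exact ⟨heq, heq.trans (hsum.trans (entanglementOfParticles_eq nA hN).symm)⟩
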